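/- Let $n\in\mathbb N$, $\alpha>0$, $B>0$ and $K=[0,1]^n$. For $f\colon K\to\mathbb R$ put $$\|f\|_{\mathcal C^\alpha}=\max_{|\beta|<\lfloor\alpha\rfloor}\ \sup_{x\in K}|\partial^\beta f(x)|+\max_{|\beta|=\lfloor\alpha\rfloor}\ \sup_{x,x'\in K,\,x\neq x'}\frac{|\partial^\beta f(x)-\partial^\beta f(x')|}{\|x-x'\|_\infty^{\alpha-\lfloor\alpha\rfloor}}$$ (the first maximum is $0$ if $\lfloor\alpha\rfloor=0$), and let $\mathcal C^\alpha_B$ be the set of continuous $f\colon K\to\mathbb R$ all of whose partial derivatives up to order $\lfloor\alpha\rfloor$ exist on $K$ (one-sided on the faces of $K$) and which satisfy $\|f\|_{\mathcal C^\alpha}\le B$. Here the maxima run over all iterated partial derivatives of the indicated order, taken in any order of differentiation. A permutation $\sigma\in S_n$ acts on $\mathbb R^n$ by $(\sigma\cdot x)_i=x_{\sigma^{-1}(i)}$, and for a subgroup $G\subset S_n$ a map $F\colon K\to\mathbb R^n$ is called $G$-equivariant if $F(\sigma\cdot x)=\sigma\cdot F(x)$ for all $\sigma\in G$ and $x\in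 K$. A ReLU network is a composition of finitely many layers, where each layer is an affine map $x\mapsto Wx+b$, followed, except in the last layer, by $t\mapsto\max(t,0)$ in each coordinate; its parameters are the entries of all the matrices $W$ and vectors $b$. Then there are functions $L,P\colon(0,\infty)\to\mathbb N$, depending only on $n$, $\alpha$ and $B$, with $$L(\varepsilon)=O(\log(1/\varepsilon)),\qquad P(\varepsilon)=O\bigl(\varepsilon^{-n/\alpha}\log(1/\varepsilon)\bigr)\qquad(\varepsilon\to0^+),$$ such that the following holds. For every subgroup $G\subset S_n$, with $k$ the number of its orbits on $\{1,\dots,n\}$, every $\varepsilon>0$, and every $G$-equivariant map $F\colon K\to\mathbb R^n$ all of whose components lie in $\mathcal C^\alpha_B$, there is a ReLU network with at most $L(\varepsilon)$ layers and at most $k\,P(\varepsilon)$ nonzero parameters that computes a function $\widehat F\colon\mathbb R^n\to\mathbb R^n$ which is $G$-equivariant on $K$ and satisfies $$\sup_{x\in K}\|\widehat F(x)-F(x)\|_\infty\le\varepsilon .$$ -/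

import Mathlib

open Filter Topology Asymptotics
open scoped ENNReal

/-- The unit cube `[0,1]^n` in `ℝ^n` (with the supremum norm). -/
def unitCube (n : ℕ) : Set (Fin n → ℝ) := Set.Icc 0 1

/-- The restriction of `f` to the line through `x` in the direction of the `i`-th coordinate,
parametrised by the value `t` of that coordinate. -/
def coordSlice {n : ℕ} (i : Fin n) (f : (Fin n → ℝ) → ℝ) (x : Fin n → ℝ) (t : ℝ) : ℝ :=
  f (Function.update x i t)

/-- The partial derivative `∂_i f` of a function on the unit cube (one-sided on the faces
`x i = 0` and `x i = 1`). At points of the cube it depends only on `f` on the cube. -/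
noncomputable def cubePartial {n : ℕ} (i : Fin n) (f : (Fin n → ℝ) → ℝ) :
    (Fin n → ℝ) → ℝ :=
  fun x => derivWithin (coordSlice i f x) (Set.Icc 0 1) (x i)

/-- The iterated partial derivative `∂_{i₁} ∂_{i₂} ⋯ ∂_{i_r} f` for `l = [i₁, …, i_r]`;
its order is `l.length`. -/
noncomputable def cubeIterPartial {n : ℕ} (l : List (Fin n)) (f : (Fin n → ℝ) → ℝ) :
    (Fin n → ℝ) → ℝ :=
  l.foldr cubePartial f

/-- All partial derivatives of `f` up to order `m` exist at every point of the unit cube. -/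
def HasCubePartials {n : ℕ} (m : ℕ) (f : (Fin n → ℝ) → ℝ) : Prop :=
  ∀ l : List (Fin n), l.length < m → ∀ i : Fin n, ∀ x ∈ unitCube n,
    DifferentiableWithinAt ℝ (coordSlice i (cubeIterPartial l f) x) (Set.Icc 0 1) (x i)

/-- The Hölder norm of order `α` on the unit cube, with values in `[0,∞]`:
`max_{|β| < ⌊α⌋} sup |∂^β f| + max_{|β| = ⌊α⌋} sup_{x ≠ x'} |∂^β f x - ∂^β f x'| / ‖x - x'‖^(α-⌊α⌋)`.
-/
noncomputable def holderENorm {n : ℕ} (α : ℝ) (f : (Fin n → ℝ) → ℝ) : ℝ≥0∞ :=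
  (⨆ (l : List (Fin n)) (_ : l.length < ⌊α⌋₊) (x ∈ unitCube n),
      ENNReal.ofReal |cubeIterPartial l f x|) +
    ⨆ (l : List (Fin n)) (_ : l.length = ⌊α⌋₊) (x ∈ unitCube n) (x' ∈ unitCube n) (_ : x ≠ x'),
      ENNReal.ofReal
        (|cubeIterPartial l f x - cubeIterPartial l f x'| / ‖x - x'‖ ^ (α - (⌊α⌋₊ : ℝ)))

/-- The ball `C^α_B` of radius `B` in the Hölder space of order `α` on the unit cube. -/
def holderBall (n : ℕ) (α B : ℝ) : Set ((Fin n → ℝ) → ℝ) :=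
  {f | ContinuousOn f (unitCube n) ∧ HasCubePartials ⌊α⌋₊ f ∧
    holderENorm α f ≤ ENNReal.ofReal B}

/-- The action of a permutation on `ℝ^n`: `(σ · x) i = x (σ⁻¹ i)`. -/
def permAct {n : ℕ} (σ : Equiv.Perm (Fin n)) (x : Fin n → ℝ) : Fin n → ℝ :=
  fun i => x (σ⁻¹ i)

/-- `F`, as a map from the unit cube to `ℝ^n`, is `G`-equivariant. -/
def IsCubeEquivariant {n : ℕ} (G : Subgroup (Equiv.Perm (Fin n)))
    (F : (Fin n → ℝ) → (Fin n → ℝ)) : Prop :=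
  ∀ σ ∈ G, ∀ x ∈ unitCube n, F (permAct σ x) = permAct σ (F x)

/-- The number of orbits of `G` on `{1, …, n}`. -/
noncomputable def numOrbits {n : ℕ} (G : Subgroup (Equiv.Perm (Fin n))) : ℕ :=
  Nat.card (MulAction.orbitRel.Quotient G (Fin n))

/-- Feedforward ReLU networks from `ℝ^p` to `ℝ^q`: a final affine layer `x ↦ W x + b`, preceded by
any number of hidden layers `x ↦ ReLU (W x + b)` of arbitrary widths. -/
inductive ReLUNet : ℕ → ℕ → Type
  | output {p q : ℕ} (W : Matrix (Fin q) (Fin p) ℝ) (b : Fin q → ℝ) : ReLUNet p q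
  | hidden {p r q : ℕ} (W : Matrix (Fin r) (Fin p) ℝ) (b : Fin r → ℝ) (N : ReLUNet r q) :
      ReLUNet p q

namespace ReLUNet

/-- The function computed by a network. -/
def eval : {p q : ℕ} → ReLUNet p q → (Fin p → ℝ) → (Fin q → ℝ)
  | _, _, output W b => fun x => W.mulVec x + b
  | _, _, hidden W b N => fun x => N.eval (fun j => max (W.mulVec x j + b j) 0)

/-- The number of layers (hidden layers and the output layer). -/
def numLayers : {p q : ℕ} → ReLUNet p q → ℕ
  | _, _, output _ _ => 1
  | _, _, hidden _ _ N => N.numLayers + 1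

/-- The number of nonzero entries of a weight matrix and a bias vector. -/
noncomputable def layerParams {p q : ℕ} (W : Matrix (Fin q) (Fin p) ℝ) (b : Fin q → ℝ) : ℕ :=
  {ij : Fin q × Fin p | W ij.1 ij.2 ≠ 0}.ncard + {i : Fin q | b i ≠ 0}.ncard

/-- The total number of nonzero parameters (weights and biases) of a network. -/
noncomputable def numParams : {p q : ℕ} → ReLUNet p q → ℕ
  | _, _, output W b => layerParams W b
  | _, _, hidden W b N => layerParams W b + N.numParams

end ReLUNet

/-! Each component of `F` is approximated by a linear combination of one fixed finite family of
functions, and the resulting map is then averaged over `G`. The family consists of the products over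
all coordinates of `blendFn`, a hat function on a grid of mesh `1/N` times a Lagrange basis
polynomial of degree `⌊α⌋`. A Hölder function is, along each coordinate line, locally within
`O(N^(-α))` of a polynomial of degree at most `⌊α⌋`, and `sum_abs_blendFn_le` bounds the
reconstruction operator independently of `N`. Hence `tensor_blend_error` and
`holderBall.exists_blend` give error `O(N^(-α))` with `O(N^n)` terms and coefficients at most `2 *
B`.

Each product is computed by a network of fixed width and depth `O(s)` up to an error polynomial in
`N` times `4^(-s)` (`exists_computes_blend`): iterated tent maps approximate `x * (1 - x)`, and
polarization turns this into multiplication. So `N ~ ε^(-1/α)` and `s ~ log(1/ε)` suffice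
(`exists_grid_depth`).

Averaging over `G` gives exact equivariance and, as `F` is equivariant, does not increase the error.
Precomposing a term with a permutation changes only its first layer, so the average is a combination
of at most `n!` times as many scalar networks, run in parallel and mixed by the output layer
(`ReLUNet.exists_of_computes`). The constant `n!` depends only on `n`; the number of orbits enters
only through being at least `1` when `n > 0`. -/

/-! ### Functions computed by networks of fixed width -/

/-- The affine combinations of a family of real functions. -/
def affSpan {ι D : Type*} (T : ι → D → ℝ) : Submodule ℝ (D → ℝ) :=
  Submodule.span ℝ (insert 1 (Set.range T))

lemma mem_affSpan_iff {ι D : Type*} [Fintype ι] {T : ι → D → ℝ} {f : D → ℝ} :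
    f ∈ affSpan T ↔ ∃ (a : ι → ℝ) (b : ℝ), ∀ x, f x = ∑ r, a r * T r x + b := by
  unfold affSpan
  rw [Submodule.mem_span_insert]
  constructor
  · rintro ⟨b, z, hz, rfl⟩
    obtain ⟨a, rfl⟩ := (Submodule.mem_span_range_iff_exists_fun ℝ).1 hz
    exact ⟨a, b, fun x => by simp [add_comm]⟩
  · rintro ⟨a, b, h⟩
    refine ⟨b, ∑ r, a r • T r, (Submodule.mem_span_range_iff_exists_fun ℝ).2 ⟨a, rfl⟩, ?_⟩
    ext x
    simp [h, add_comm]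

lemma one_mem_affSpan {ι D : Type*} (T : ι → D → ℝ) : (1 : D → ℝ) ∈ affSpan T :=
  Submodule.subset_span (Set.mem_insert _ _)

lemma mem_affSpan_self {ι D : Type*} (T : ι → D → ℝ) (i : ι) : T i ∈ affSpan T :=
  Submodule.subset_span (Set.mem_insert_of_mem _ ⟨i, rfl⟩)

lemma affSpan_comp {ι D E : Type*} [Fintype ι] {T : ι → D → ℝ} {f : D → ℝ} (hf : f ∈ affSpan T)
    (u : E → D) : f ∘ u ∈ affSpan (fun i => T i ∘ u) := by
  rw [mem_affSpan_iff] at hf ⊢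
  obtain ⟨a, b, h⟩ := hf
  exact ⟨a, b, fun x => h (u x)⟩

/-- The coordinate functions on the unit cube. -/
def cubeCoord (n : ℕ) (i : Fin n) (x : unitCube n) : ℝ := x.1 i

/-- `T` lists the values of the `w` neurons in the hidden layer number `L` (counted from `0`) of
some network with hidden layers of width `w`, as functions on the unit cube. -/
def HiddenState (n w : ℕ) : ℕ → (Fin w → unitCube n → ℝ) → Prop
  | 0, T => ∀ r, ∃ φ ∈ affSpan (cubeCoord n), T r = φ ⊔ 0
  | L + 1, T => ∃ T', HiddenState n w L T' ∧ ∀ r, ∃ φ ∈ affSpan T', T r = φ ⊔ 0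

/-- All functions in `S` are affine combinations of the neurons of hidden layer number `L` of one
network of width `w`. -/
def Computes (n w L : ℕ) (S : Set (unitCube n → ℝ)) : Prop :=
  ∃ T, HiddenState n w L T ∧ S ⊆ affSpan T

lemma exists_layer {D ι : Type*} [Fintype ι] {w : ℕ} (hw : Fintype.card ι ≤ w)
    {V : Submodule ℝ (D → ℝ)} {φ : ι → D → ℝ} (hφ : ∀ i, φ i ∈ V) :
    ∃ T : Fin w → D → ℝ, (∀ r, ∃ ψ ∈ V, T r = ψ ⊔ 0) ∧
      affSpan (fun i => φ i ⊔ 0) ≤ affSpan T := by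
  obtain ⟨e⟩ := Function.Embedding.nonempty_of_card_le (α := ι) (β := Fin w) (by simpa using hw)
  -- Neurons outside the range of `e` get pre-activation `0`, so every layer has width exactly `w`.
  refine ⟨fun r => Function.extend e φ 0 r ⊔ 0, fun r => ⟨_, ?_, rfl⟩, ?_⟩
  · by_cases h : ∃ i, e i = r
    · obtain ⟨i, rfl⟩ := h
      rw [e.injective.extend_apply]
      exact hφ i
    · rw [Function.extend_apply' _ _ _ h]
      exact V.zero_mem
  · refine Submodule.span_mono (Set.insert_subset_insert ?_)
    rintro _ ⟨i, rfl⟩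
    exact ⟨e i, by simp [e.injective.extend_apply]⟩

lemma Computes.first {n w : ℕ} {ι : Type*} [Fintype ι] (hw : Fintype.card ι ≤ w)
    {φ : ι → unitCube n → ℝ} (hφ : ∀ i, φ i ∈ affSpan (cubeCoord n))
    {S : Set (unitCube n → ℝ)} (hS : S ⊆ affSpan (fun i => φ i ⊔ 0)) : Computes n w 0 S := by
  obtain ⟨T, hT, hle⟩ := exists_layer hw hφ
  exact ⟨T, hT, hS.trans hle⟩

lemma Computes.of_subset {n w L : ℕ} {S S' : Set (unitCube n → ℝ)} (h : Computes n w L S)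
    (hS : S' ⊆ Submodule.span ℝ (insert 1 S)) : Computes n w L S' := by
  obtain ⟨T, hT, hST⟩ := h
  refine ⟨T, hT, hS.trans (Submodule.span_le.2 ?_)⟩
  exact Set.insert_subset (one_mem_affSpan T) hST

/-- Affine maps between consecutive layers compose, so the new pre-activations may be any affine
combinations of `S` at no extra depth. -/
lemma Computes.next {n w L : ℕ} {S : Set (unitCube n → ℝ)} (h : Computes n w L S)
    {ι : Type*} [Fintype ι] (hw : Fintype.card ι ≤ w)
    {φ : ι → unitCube n → ℝ} (hφ : ∀ i, φ i ∈ Submodule.span ℝ (insert 1 S))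
    {S' : Set (unitCube n → ℝ)} (hS : S' ⊆ affSpan (fun i => φ i ⊔ 0)) :
    Computes n w (L + 1) S' := by
  obtain ⟨T, hT, hle⟩ := exists_layer hw hφ
  obtain ⟨T₀, hT₀, hST⟩ := h
  refine ⟨T, ⟨T₀, hT₀, fun r => ?_⟩, hS.trans hle⟩
  obtain ⟨ψ, hψ, h⟩ := hT r
  refine ⟨ψ, Submodule.span_le.2 ?_ hψ, h⟩
  exact Set.insert_subset (one_mem_affSpan T₀) hST

/-! ### Permuting the inputs of a network -/

lemma permAct_mem_unitCube {n : ℕ} (σ : Equiv.Perm (Fin n)) {x : Fin n → ℝ}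
    (hx : x ∈ unitCube n) : permAct σ x ∈ unitCube n :=
  ⟨fun i => hx.1 (σ⁻¹ i), fun i => hx.2 (σ⁻¹ i)⟩

/-- The action of a permutation on the unit cube. -/
def cubePerm {n : ℕ} (σ : Equiv.Perm (Fin n)) (x : unitCube n) : unitCube n :=
  ⟨permAct σ x.1, permAct_mem_unitCube σ x.2⟩

/-- A permutation of the coordinates only relabels the columns of the first weight matrix; all later
layers are unchanged. -/
lemma HiddenState.comp_cubePerm {n w : ℕ} (σ : Equiv.Perm (Fin n)) {L : ℕ}
    {T : Fin w → unitCube n → ℝ} (h : HiddenState n w L T) :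
    HiddenState n w L (fun r => T r ∘ cubePerm σ) := by
  induction L generalizing T with
  | zero =>
    intro r
    obtain ⟨φ, hφ, hr⟩ := h r
    refine ⟨φ ∘ cubePerm σ, Submodule.span_mono (Set.insert_subset_insert ?_)
      (affSpan_comp hφ (cubePerm σ)), congrArg (· ∘ cubePerm σ) hr⟩
    rintro _ ⟨i, rfl⟩
    exact ⟨σ⁻¹ i, rfl⟩
  | succ L ih =>
    obtain ⟨T', hT', h⟩ := h
    refine ⟨_, ih hT', fun r => ?_⟩
    obtain ⟨φ, hφ, hr⟩ := h r
    exact ⟨φ ∘ cubePerm σ, affSpan_comp hφ _, congrArg (· ∘ cubePerm σ) hr⟩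

lemma Computes.comp_cubePerm {n w L : ℕ} (σ : Equiv.Perm (Fin n)) {f : unitCube n → ℝ}
    (h : Computes n w L {f}) : Computes n w L {f ∘ cubePerm σ} := by
  obtain ⟨T, hT, hf⟩ := h
  refine ⟨_, hT.comp_cubePerm σ, ?_⟩
  rw [Set.singleton_subset_iff] at hf ⊢
  exact affSpan_comp hf _

/-! ### Parallel composition and parameter counts -/

namespace ReLUNet

lemma layerParams_le {p q : ℕ} (W : Matrix (Fin q) (Fin p) ℝ) (b : Fin q → ℝ) :
    layerParams W b ≤ q * p + q := by
  unfold layerParams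
  gcongr
  · exact (Set.ncard_le_card _).trans (by simp)
  · exact (Set.ncard_le_card _).trans (by simp)

/-- Nonzero weights occur only inside the diagonal blocks, so the count is linear in the number of
blocks rather than quadratic. -/
lemma layerParams_le_of_blockDiagonal {Ω : Type*} [Fintype Ω] {w p : ℕ}
    (e : Ω × Fin w ≃ Fin p) (W : Matrix (Fin p) (Fin p) ℝ) (b : Fin p → ℝ)
    (hW : ∀ u v, u.1 ≠ v.1 → W (e u) (e v) = 0) :
    layerParams W b ≤ Fintype.card Ω * (w * (w + 1)) := by
  have hp : p = Fintype.card Ω * w := by simpa using (Fintype.card_congr e).symm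
  have h1 : {ij : Fin p × Fin p | W ij.1 ij.2 ≠ 0}.ncard ≤ Fintype.card Ω * (w * w) := by
    let ν : Ω × Fin w × Fin w → Fin p × Fin p := fun u => (e (u.1, u.2.1), e (u.1, u.2.2))
    have hsub : {ij : Fin p × Fin p | W ij.1 ij.2 ≠ 0} ⊆ Set.range ν := by
      rintro ⟨i, j⟩ hij
      obtain ⟨⟨ω, r⟩, rfl⟩ := e.surjective i
      obtain ⟨⟨ω', s⟩, rfl⟩ := e.surjective j
      by_cases h : ω = ω'
      · subst h
        exact ⟨(ω, r, s), rfl⟩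
      · exact absurd (hW _ _ h) hij
    calc _ ≤ (Set.range ν).ncard := Set.ncard_le_ncard hsub (Set.toFinite _)
      _ ≤ (Set.univ : Set (Ω × Fin w × Fin w)).ncard := by
        rw [← Set.image_univ]
        exact Set.ncard_image_le
      _ = _ := by simp [Set.ncard_univ]
  have h2 : {i : Fin p | b i ≠ 0}.ncard ≤ p := (Set.ncard_le_card _).trans (by simp)
  unfold layerParams
  calc _ ≤ Fintype.card Ω * (w * w) + p := by gcongr
    _ = _ := by rw [hp]; ring

/-- Induction from the output side: the last hidden layer of all the parallel networks becomes one
block-diagonal layer in front of `N`, and the shorter networks are then prepended to the result. -/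
lemma exists_prepend_hiddenState {n w : ℕ} {Ω : Type*} [Fintype Ω] {p : ℕ}
    (e : Ω × Fin w ≃ Fin p) (L : ℕ) {q : ℕ} (N : ReLUNet p q) (T : Ω → Fin w → unitCube n → ℝ)
    (hT : ∀ ω, HiddenState n w L (T ω)) :
    ∃ N' : ReLUNet n q, N'.numLayers = N.numLayers + (L + 1) ∧
      N'.numParams ≤ N.numParams +
        Fintype.card Ω * (w * (n + 1) + L * (w * (w + 1))) ∧
      ∀ x : unitCube n, N'.eval x.1 = N.eval (fun i => T (e.symm i).1 (e.symm i).2 x) := by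
  have hp : p = Fintype.card Ω * w := by simpa using (Fintype.card_congr e).symm
  induction L generalizing N T with
  | zero =>
    have key : ∀ ω r, ∃ (a : Fin n → ℝ) (b : ℝ), ∀ x : unitCube n,
        T ω r x = max (∑ i, a i * x.1 i + b) 0 := by
      intro ω r
      obtain ⟨φ, hφ, hr⟩ := hT ω r
      obtain ⟨a, b, h⟩ := mem_affSpan_iff.1 hφ
      exact ⟨a, b, fun x => by simp [hr, h, cubeCoord]⟩
    choose a b hab using key
    refine ⟨hidden (fun i => a (e.symm i).1 (e.symm i).2) (fun i => b (e.symm i).1 (e.symm i).2) N,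
      rfl, ?_, fun x => ?_⟩
    · have := layerParams_le (fun i => a (e.symm i).1 (e.symm i).2)
        (fun i => b (e.symm i).1 (e.symm i).2)
      calc _ ≤ (p * n + p) + N.numParams := by
            simp only [numParams]; gcongr
        _ = _ := by
            generalize N.numParams = c
            rw [hp]; ring
    · simp only [eval]
      congr 1
      ext i
      simp [hab, Matrix.mulVec, dotProduct]
  | succ L ih =>
    choose T' hT' h using hT
    have key : ∀ ω r, ∃ (a : Fin w → ℝ) (b : ℝ), ∀ x : unitCube n,
        T ω r x = max (∑ i, a i * T' ω i x + b) 0 := by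
      intro ω r
      obtain ⟨φ, hφ, hr⟩ := h ω r
      obtain ⟨a, b, h⟩ := mem_affSpan_iff.1 hφ
      exact ⟨a, b, fun x => by simp [hr, h]⟩
    choose a b hab using key
    classical
    let W : Matrix (Fin p) (Fin p) ℝ := fun i j =>
      if (e.symm i).1 = (e.symm j).1 then a (e.symm i).1 (e.symm i).2 (e.symm j).2 else 0
    let c : Fin p → ℝ := fun i => b (e.symm i).1 (e.symm i).2
    have hW := layerParams_le_of_blockDiagonal e W c (fun u v huv => by simp [W, huv])
    obtain ⟨N', h1, h2, h3⟩ := ih (hidden W c N) T' hT'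
    refine ⟨N', by rw [h1]; simp only [numLayers]; ring, ?_, fun x => ?_⟩
    · simp only [numParams] at h2
      calc _ ≤ _ := h2
        _ ≤ Fintype.card Ω * (w * (w + 1)) + N.numParams + _ := by gcongr
        _ = _ := by ring
    · rw [h3]
      simp only [eval]
      congr 1
      ext i
      rw [hab]
      congr 2
      simp only [Matrix.mulVec, dotProduct, W]
      rw [← e.sum_comp, Fintype.sum_prod_type]
      simp

/-- Linear combinations of finitely many scalar functions, each computed by a network of width `w`
with `L + 1` hidden layers, are computed by a network whose size is linear in their number. -/
lemma exists_of_computes {n w L : ℕ} {Ω : Type*} [Fintype Ω] [Nonempty Ω] {φ : Ω → unitCube n → ℝ}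
    (hφ : ∀ ω, Computes n w L {φ ω}) {q : ℕ} (M : Fin q → Ω → ℝ) (c : Fin q → ℝ) :
    ∃ N : ReLUNet n q, N.numLayers = L + 2 ∧
      N.numParams ≤ Fintype.card Ω * (w * (n + 1) + L * (w * (w + 1)) + q * (w + 1)) ∧
      ∀ (x : unitCube n) (i : Fin q), N.eval x.1 i = ∑ ω, M i ω * φ ω x + c i := by
  choose T hT hφT using hφ
  have key : ∀ ω, ∃ (a : Fin w → ℝ) (b : ℝ), ∀ x, φ ω x = ∑ r, a r * T ω r x + b := fun ω =>
    mem_affSpan_iff.1 (hφT ω rfl)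
  choose a b hab using key
  let e := Fintype.equivFin (Ω × Fin w)
  let N₀ : ReLUNet (Fintype.card (Ω × Fin w)) q :=
    output (fun i j => M i (e.symm j).1 * a (e.symm j).1 (e.symm j).2)
      (fun i => ∑ ω, M i ω * b ω + c i)
  obtain ⟨N, h1, h2, h3⟩ := exists_prepend_hiddenState e L N₀ T hT
  refine ⟨N, by rw [h1]; simp only [N₀, numLayers]; ring, ?_, fun x i => ?_⟩
  -- Nonemptiness of `Ω` lets the `q` output biases be absorbed into a multiple of `Fintype.card Ω`.
  · have hΩ : 1 ≤ Fintype.card Ω := Fintype.card_pos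
    have hN₀ : N₀.numParams ≤ q * (Fintype.card Ω * w) + q := by
      have := layerParams_le (fun i j => M i (e.symm j).1 * a (e.symm j).1 (e.symm j).2)
        (fun i => ∑ ω, M i ω * b ω + c i)
      exact this.trans_eq (by rw [Fintype.card_prod, Fintype.card_fin])
    calc _ ≤ _ := h2
      _ ≤ q * (Fintype.card Ω * w) + q * Fintype.card Ω + _ := by
        gcongr
        exact hN₀.trans (by gcongr; exact Nat.le_mul_of_pos_right _ hΩ)
      _ = _ := by ring
  · rw [h3]
    simp only [N₀, eval, Pi.add_apply, Matrix.mulVec, dotProduct]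
    rw [← e.sum_comp, Fintype.sum_prod_type, ← add_assoc, ← Finset.sum_add_distrib]
    simp only [Equiv.symm_apply_apply, hab, mul_add, Finset.mul_sum, mul_assoc]

end ReLUNet

/-! ### Tent maps and approximate multiplication -/

/-- The tent map, written with two rectifiers. -/
noncomputable def tent (x : ℝ) : ℝ := max (2 * x) 0 - max (4 * x - 2) 0

lemma tent_mem {x : ℝ} (hx : x ∈ Set.Icc (0 : ℝ) 1) : tent x ∈ Set.Icc (0 : ℝ) 1 := by
  obtain ⟨h0, h1⟩ := hx
  unfold tent
  rw [max_eq_left (by linarith)]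
  constructor <;> rcases max_cases (4 * x - 2) 0 with ⟨h, _⟩ | ⟨h, _⟩ <;> rw [h] <;> linarith

/-- The self-similarity `g = (tent + g ∘ tent) / 4` of the parabola `g x = x * (1 - x)`; iterating
it produces `tentSum` with an exact remainder. -/
lemma mul_one_sub_eq_tent {x : ℝ} (hx : 0 ≤ x) :
    x * (1 - x) = (tent x + tent x * (1 - tent x)) / 4 := by
  unfold tent
  rw [max_eq_left (by linarith)]
  rcases max_cases (4 * x - 2) 0 with ⟨h, _⟩ | ⟨h, _⟩ <;> rw [h] <;> ring

lemma tent_iterate_mem {x : ℝ} (hx : x ∈ Set.Icc (0 : ℝ) 1) (s : ℕ) :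
    tent^[s] x ∈ Set.Icc (0 : ℝ) 1 := by
  induction s with
  | zero => exact hx
  | succ s ih => rw [Function.iterate_succ_apply']; exact tent_mem ih

/-- The sums of iterated tent maps which approximate `x * (1 - x)`. -/
noncomputable def tentSum (s : ℕ) (x : ℝ) : ℝ := ∑ i ∈ Finset.range s, tent^[i + 1] x / 4 ^ (i + 1)

lemma tentSum_nonneg {x : ℝ} (hx : x ∈ Set.Icc (0 : ℝ) 1) (s : ℕ) : 0 ≤ tentSum s x :=
  Finset.sum_nonneg fun i _ => div_nonneg (tent_iterate_mem hx _).1 (by positivity)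

lemma mul_one_sub_sub_tentSum {x : ℝ} (hx : x ∈ Set.Icc (0 : ℝ) 1) (s : ℕ) :
    x * (1 - x) - tentSum s x = tent^[s] x * (1 - tent^[s] x) / 4 ^ s := by
  induction s with
  | zero => simp [tentSum]
  | succ s ih =>
    have h : tentSum (s + 1) x = tentSum s x + tent^[s + 1] x / 4 ^ (s + 1) :=
      Finset.sum_range_succ _ _
    rw [h, ← sub_sub, ih, mul_one_sub_eq_tent (tent_iterate_mem hx s).1,
      ← Function.iterate_succ_apply' tent s x]
    field_simp
    ring

lemma tentSum_approx {x : ℝ} (hx : x ∈ Set.Icc (0 : ℝ) 1) (s : ℕ) :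
    0 ≤ x * (1 - x) - tentSum s x ∧ x * (1 - x) - tentSum s x ≤ (1 / 4) * (1 / 4 ^ s) := by
  rw [mul_one_sub_sub_tentSum hx, mul_one_div]
  obtain ⟨h0, h1⟩ := tent_iterate_mem hx s
  constructor
  · exact div_nonneg (mul_nonneg h0 (by linarith)) (by positivity)
  · gcongr
    nlinarith [sq_nonneg (tent^[s] x - 1 / 2)]

/-- If `a` and `b` encode `2 * a - 1` and `2 * b - 1`, then `approxMul s a b` encodes an
approximation of their product. -/
noncomputable def approxMul (s : ℕ) (a b : ℝ) : ℝ :=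
  max (1 - max (4 * tentSum s ((a + b) / 2) - tentSum s a - tentSum s b) 0) 0

lemma approxMul_mem (s : ℕ) (a b : ℝ) : approxMul s a b ∈ Set.Icc (0 : ℝ) 1 :=
  ⟨le_max_right _ _, max_le (sub_le_self _ (le_max_right _ _)) zero_le_one⟩

/-- Polarization: with `g x = x * (1 - x)` one has `4 * g ((a + b) / 2) - g a - g b = a + b - 2 * a
* b`, and `(2 * a - 1) * (2 * b - 1)` is `1` minus twice this quantity. The quantity lies in `[0,
1]`, so the two clamps in `approxMul` fix the exact value; being 1-Lipschitz, they do not increase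
the error. -/
lemma approxMul_error (s : ℕ) {a b : ℝ} (ha : a ∈ Set.Icc (0 : ℝ) 1) (hb : b ∈ Set.Icc (0 : ℝ) 1) :
    |(2 * approxMul s a b - 1) - (2 * a - 1) * (2 * b - 1)| ≤ 3 * (1 / 4 ^ s) := by
  have hz : (a + b) / 2 ∈ Set.Icc (0 : ℝ) 1 :=
    ⟨by linarith [ha.1, hb.1], by linarith [ha.2, hb.2]⟩
  obtain ⟨a1, a2⟩ := tentSum_approx ha s
  obtain ⟨b1, b2⟩ := tentSum_approx hb s
  obtain ⟨z1, z2⟩ := tentSum_approx hz s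
  have hδ : (0 : ℝ) < 1 / 4 ^ s := by positivity
  set δ : ℝ := 1 / 4 ^ s
  set u := 4 * tentSum s ((a + b) / 2) - tentSum s a - tentSum s b with hu
  have hprod : (2 * a - 1) * (2 * b - 1) = 1 - 2 * (a + b - 2 * a * b) := by ring
  have h0 : 0 ≤ a + b - 2 * a * b := by nlinarith [ha.1, ha.2, hb.1, hb.2]
  have h1 : a + b - 2 * a * b ≤ 1 := by nlinarith [ha.1, ha.2, hb.1, hb.2]
  have hv : |u - (a + b - 2 * a * b)| ≤ 3 / 2 * δ := by
    rw [abs_le]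
    constructor <;> nlinarith
  have hc : |approxMul s a b - (1 - (a + b - 2 * a * b))| ≤ |u - (a + b - 2 * a * b)| := by
    have e1 : approxMul s a b - (1 - (a + b - 2 * a * b)) =
        max (1 - max u 0) 0 - max (1 - max (a + b - 2 * a * b) 0) 0 := by
      rw [max_eq_left h0, max_eq_left (by linarith : (0 : ℝ) ≤ 1 - (a + b - 2 * a * b))]
      rfl
    rw [e1]
    refine (abs_max_sub_max_le_abs _ _ _).trans ?_
    rw [sub_sub_sub_cancel_left, abs_sub_comm]
    exact abs_max_sub_max_le_abs _ _ _
  rw [hprod, show 2 * approxMul s a b - 1 - (1 - 2 * (a + b - 2 * a * b)) =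
    2 * (approxMul s a b - (1 - (a + b - 2 * a * b))) by ring, abs_mul, abs_two]
  linarith

lemma sup_zero_of_nonneg {D : Type*} {f : D → ℝ} (hf : ∀ x, 0 ≤ f x) : f ⊔ 0 = f :=
  sup_eq_left.2 hf

/-! ### Networks for products -/

section
variable {n w L : ℕ}

/-- One layer per tent iteration. Each `v c` costs three neurons, two for the tent map and one for
the running sum; the running sums and the `U k` are nonnegative and therefore pass through the
rectifier unchanged. -/
lemma computes_tentSum {S : Set (unitCube n → ℝ)} (h : Computes n w L S)
    {γ κ : Type*} [Fintype γ] [Fintype κ] (hw : 3 * Fintype.card γ + Fintype.card κ ≤ w)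
    {v : γ → unitCube n → ℝ} (hv : ∀ c, v c ∈ Submodule.span ℝ (insert 1 S))
    (hv01 : ∀ c x, v c x ∈ Set.Icc (0 : ℝ) 1)
    {U : κ → unitCube n → ℝ} (hU : ∀ k, U k ∈ Submodule.span ℝ (insert 1 S))
    (hU0 : ∀ k x, 0 ≤ U k x) (s : ℕ) :
    Computes n w (L + s) (Set.range (fun c x => tent^[s] (v c x)) ∪
      Set.range (fun c x => tentSum s (v c x)) ∪ Set.range U) := by
  induction s with
  | zero =>
    refine h.of_subset ?_
    rintro _ ((⟨c, rfl⟩ | ⟨c, rfl⟩) | ⟨k, rfl⟩)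
    · exact hv c
    · simp only [tentSum, Finset.range_zero, Finset.sum_empty]
      exact Submodule.zero_mem _
    · exact hU k
  | succ s ih =>
    let φ : ((γ ⊕ γ) ⊕ γ) ⊕ κ → unitCube n → ℝ := Sum.elim (Sum.elim (Sum.elim
      (fun c => (2 : ℝ) • fun x => tent^[s] (v c x))
      (fun c => (4 : ℝ) • (fun x => tent^[s] (v c x)) - (2 : ℝ) • 1))
      (fun c x => tentSum s (v c x))) U
    have h1 : (1 : unitCube n → ℝ) ∈ Submodule.span ℝ (insert 1 (Set.range
        (fun c x => tent^[s] (v c x)) ∪ Set.range (fun c x => tentSum s (v c x)) ∪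
        Set.range U)) := Submodule.subset_span (Set.mem_insert _ _)
    have h2 : ∀ c, (fun x => tent^[s] (v c x)) ∈ Submodule.span ℝ (insert 1 (Set.range
        (fun c x => tent^[s] (v c x)) ∪ Set.range (fun c x => tentSum s (v c x)) ∪
        Set.range U)) := fun c => Submodule.subset_span (Or.inr (Or.inl (Or.inl ⟨c, rfl⟩)))
    have ht : ∀ c, (fun x => tent^[s + 1] (v c x)) ∈ affSpan (fun i => φ i ⊔ 0) := by
      intro c
      have : (fun x => tent^[s + 1] (v c x)) =
          (φ (.inl (.inl (.inl c))) ⊔ 0) - (φ (.inl (.inl (.inr c))) ⊔ 0) := by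
        ext x
        simp [φ, Function.iterate_succ_apply', tent]
      rw [this]
      exact Submodule.sub_mem _ (mem_affSpan_self (fun i => φ i ⊔ 0) _)
        (mem_affSpan_self (fun i => φ i ⊔ 0) _)
    refine ih.next (φ := φ) ?_ ?_ ?_
    · simp only [Fintype.card_sum]; omega
    · rintro (((c | c) | c) | k)
      · exact Submodule.smul_mem _ _ (h2 c)
      · exact Submodule.sub_mem _ (Submodule.smul_mem _ _ (h2 c)) (Submodule.smul_mem _ _ h1)
      · exact Submodule.subset_span (Or.inr (Or.inl (Or.inr ⟨c, rfl⟩)))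
      · exact Submodule.subset_span (Or.inr (Or.inr ⟨k, rfl⟩))
    · rintro _ ((⟨c, rfl⟩ | ⟨c, rfl⟩) | ⟨k, rfl⟩)
      · exact ht c
      · have : (fun x => tentSum (s + 1) (v c x)) = (φ (.inl (.inr c)) ⊔ 0) +
            (1 / 4 ^ (s + 1) : ℝ) • fun x => tent^[s + 1] (v c x) := by
          rw [show φ (.inl (.inr c)) ⊔ 0 = fun x => tentSum s (v c x) from
            sup_zero_of_nonneg fun x => tentSum_nonneg (hv01 c x) s]
          ext x
          simp only [tentSum, Finset.sum_range_succ, Pi.add_apply, Pi.smul_apply, smul_eq_mul]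
          ring
        simp only [this]
        exact Submodule.add_mem _ (mem_affSpan_self (fun i => φ i ⊔ 0) _)
          (Submodule.smul_mem _ _ (ht c))
      · have := mem_affSpan_self (fun i => φ i ⊔ 0) (.inr k)
        rwa [show φ (.inr k) ⊔ 0 = U k from sup_zero_of_nonneg (hU0 k)] at this

/-- The `9` is three neurons for each of the three arguments of `tentSum`. The depth is `s` for the
tents and `2` for the clamps, and all `U k` are carried along for later multiplications. -/
lemma computes_approxMul {κ : Type*} [Fintype κ] (hw : 9 + Fintype.card κ ≤ w)
    {U : κ → unitCube n → ℝ} (hU : ∀ k x, U k x ∈ Set.Icc (0 : ℝ) 1) {P : unitCube n → ℝ}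
    (hP : ∀ x, P x ∈ Set.Icc (0 : ℝ) 1) (h : Computes n w L (insert P (Set.range U)))
    (k : κ) (s : ℕ) :
    Computes n w (L + (s + 2)) (insert (fun x => approxMul s (P x) (U k x)) (Set.range U)) := by
  have hPm : P ∈ Submodule.span ℝ (insert 1 (insert P (Set.range U))) :=
    Submodule.subset_span (by simp)
  have hUm : ∀ k, U k ∈ Submodule.span ℝ (insert 1 (insert P (Set.range U))) := fun k =>
    Submodule.subset_span (by simp)
  let v : Fin 3 → unitCube n → ℝ := ![(1 / 2 : ℝ) • (P + U k), P, U k]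
  have h1 := computes_tentSum (v := v) h (γ := Fin 3) (by simpa using hw)
    (by
      intro c
      fin_cases c
      · exact Submodule.smul_mem _ _ (Submodule.add_mem _ hPm (hUm k))
      · exact hPm
      · exact hUm k)
    (by
      intro c x
      have a := hP x
      have b := hU k x
      fin_cases c
      · simp only [v, Fin.zero_eta, Matrix.cons_val_zero, Pi.smul_apply, Pi.add_apply, smul_eq_mul]
        exact ⟨by linarith [a.1, b.1], by linarith [a.2, b.2]⟩
      · exact a
      · exact b) hUm (fun k x => (hU k x).1) s
  set S := Set.range (fun c x => tent^[s] (v c x)) ∪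
      Set.range (fun c x => tentSum s (v c x)) ∪ Set.range U
  have hS : ∀ c, (fun x => tentSum s (v c x)) ∈ Submodule.span ℝ (insert 1 S) := fun c =>
    Submodule.subset_span (Or.inr (Or.inl (Or.inr ⟨c, rfl⟩)))
  let φ : Option κ → unitCube n → ℝ := fun o => o.elim
    ((4 : ℝ) • (fun x => tentSum s (v 0 x)) - (fun x => tentSum s (v 1 x)) -
      fun x => tentSum s (v 2 x)) U
  have h2 : Computes n w (L + s + 1) (Set.range fun i => φ i ⊔ 0) := by
    refine h1.next (φ := φ) (by rw [Fintype.card_option]; omega) ?_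
      (fun f hf => Submodule.subset_span (Or.inr hf))
    rintro (_ | k)
    · exact Submodule.sub_mem _ (Submodule.sub_mem _ (Submodule.smul_mem _ _ (hS 0)) (hS 1)) (hS 2)
    · exact Submodule.subset_span (Or.inr (Or.inr ⟨k, rfl⟩))
  have hφU : ∀ k, φ (some k) ⊔ 0 = U k := fun k => sup_zero_of_nonneg fun x => (hU k x).1
  let ψ : Option κ → unitCube n → ℝ := fun o => o.elim (1 - (φ none ⊔ 0)) U
  refine h2.next (φ := ψ) (by rw [Fintype.card_option]; omega) ?_ ?_
  · rintro (_ | k)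
    · exact Submodule.sub_mem _ (one_mem_affSpan _) (mem_affSpan_self (fun i => φ i ⊔ 0) none)
    · have := mem_affSpan_self (fun i => φ i ⊔ 0) (some k)
      rwa [hφU] at this
  · rintro _ (rfl | ⟨k, rfl⟩)
    · have := mem_affSpan_self (fun i => ψ i ⊔ 0) none
      have he : (fun x => approxMul s (P x) (U k x)) = ψ none ⊔ 0 := by
        ext x
        simp [ψ, φ, v, approxMul, inv_mul_eq_div, add_div]
      rwa [he]
    · have := mem_affSpan_self (fun i => ψ i ⊔ 0) (some k)
      rwa [show ψ (some k) ⊔ 0 = U k from sup_zero_of_nonneg fun x => (hU k x).1] at this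

/-- Approximate computation of products of finitely many numbers in `[-1, 1]`. -/
lemma exists_computes_prod {κ : Type*} [Fintype κ] (hw : 9 + Fintype.card κ ≤ w)
    {U : κ → unitCube n → ℝ} (hU : ∀ k x, U k x ∈ Set.Icc (0 : ℝ) 1)
    (h : Computes n w L (Set.range U)) (s : ℕ) :
    ∃ p : unitCube n → ℝ, Computes n w (L + Fintype.card κ * (s + 2)) {p} ∧
      ∀ x, |p x - ∏ k, (2 * U k x - 1)| ≤ Fintype.card κ * (3 * (1 / 4 ^ s)) := by
  classical
  have key : ∀ F : Finset κ, ∃ P : unitCube n → ℝ, (∀ x, P x ∈ Set.Icc (0 : ℝ) 1) ∧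
      Computes n w (L + F.card * (s + 2)) (insert P (Set.range U)) ∧
      ∀ x, |(2 * P x - 1) - ∏ k ∈ F, (2 * U k x - 1)| ≤ F.card * (3 * (1 / 4 ^ s)) := by
    intro F
    induction F using Finset.induction_on with
    | empty =>
      -- The value `1` encodes `2 * 1 - 1 = 1`, the empty product.
      refine ⟨1, fun x => by simp, ?_, fun x => by norm_num⟩
      rw [Finset.card_empty, zero_mul, add_zero]
      exact h.of_subset Submodule.subset_span
    | insert k F hk ih =>
      obtain ⟨P, hP, hc, he⟩ := ih
      refine ⟨_, fun x => approxMul_mem s (P x) (U k x), ?_, fun x => ?_⟩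
      · rw [Finset.card_insert_of_notMem hk, add_one_mul, ← add_assoc]
        exact computes_approxMul hw hU hP hc k s
      · rw [Finset.card_insert_of_notMem hk, Finset.prod_insert hk]
        have e1 := approxMul_error s (hP x) (hU k x)
        have e2 := he x
        -- A factor of modulus at most `1` does not amplify the earlier error, so the errors of
        -- successive multiplications only add.
        have hu : |2 * U k x - 1| ≤ 1 := by
          rw [abs_le]; constructor <;> linarith [(hU k x).1, (hU k x).2]
        calc _ = |((2 * approxMul s (P x) (U k x) - 1) - (2 * P x - 1) * (2 * U k x - 1)) +
              (2 * U k x - 1) * ((2 * P x - 1) - ∏ k ∈ F, (2 * U k x - 1))| := by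
              congr 1; ring
          _ ≤ 3 * (1 / 4 ^ s) + 1 * (F.card * (3 * (1 / 4 ^ s))) := by
              refine (abs_add_le _ _).trans (add_le_add e1 ?_)
              rw [abs_mul]
              exact mul_le_mul hu e2 (abs_nonneg _) zero_le_one
          _ = _ := by push_cast; ring
  obtain ⟨P, -, hc, he⟩ := key Finset.univ
  refine ⟨(2 : ℝ) • P - 1, ?_, fun x => by simpa using he x⟩
  refine hc.of_subset ?_
  rw [Set.singleton_subset_iff]
  exact Submodule.sub_mem _ (Submodule.smul_mem _ _ (Submodule.subset_span (by simp)))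
    (Submodule.subset_span (by simp))

/-- The factors are affine functions `ℓ k`, or hat functions `max (1 - |ℓ k|) 0` where
`hat k` holds. -/
lemma computes_factors {κ : Type*} [Fintype κ] (hw : 2 * Fintype.card κ ≤ w)
    {ℓ : κ → unitCube n → ℝ} (hℓ : ∀ k, ℓ k ∈ affSpan (cubeCoord n)) {hat : κ → Prop}
    [DecidablePred hat] (hlin : ∀ k, ¬ hat k → ∀ x, |ℓ k x| ≤ 1) :
    Computes n w 1 (Set.range fun k x =>
      ((if hat k then max (1 - |ℓ k x|) 0 else ℓ k x) + 1) / 2) := by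
  -- The positive and negative parts of `ℓ k` recover both `ℓ k` and `|ℓ k|`.
  let φ : κ ⊕ κ → unitCube n → ℝ := Sum.elim ℓ (fun k => -ℓ k)
  have hpos : ∀ k, ℓ k = (φ (.inl k) ⊔ 0) - (φ (.inr k) ⊔ 0) := by
    intro k
    ext x
    simp only [φ, Sum.elim_inl, Sum.elim_inr, Pi.sub_apply, Pi.sup_apply, Pi.neg_apply,
      Pi.zero_apply]
    rcases le_total 0 (ℓ k x) with h | h
    · rw [sup_eq_left.2 h, sup_eq_right.2 (by linarith)]; ring
    · rw [sup_eq_right.2 h, sup_eq_left.2 (by linarith)]; ring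
  have habs : ∀ k, |ℓ k| = (φ (.inl k) ⊔ 0) + (φ (.inr k) ⊔ 0) := by
    intro k
    ext x
    simp only [φ, Sum.elim_inl, Sum.elim_inr, Pi.add_apply, Pi.sup_apply, Pi.neg_apply,
      Pi.zero_apply, Pi.abs_apply]
    rcases le_total 0 (ℓ k x) with h | h
    · rw [sup_eq_left.2 h, sup_eq_right.2 (by linarith), abs_of_nonneg h]; ring
    · rw [sup_eq_right.2 h, sup_eq_left.2 (by linarith), abs_of_nonpos h]; ring
  have h0 : Computes n w 0 (Set.range ℓ ∪ Set.range fun k => |ℓ k|) := by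
    refine Computes.first (φ := φ) (by rw [Fintype.card_sum]; omega) ?_ ?_
    · rintro (k | k)
      · exact hℓ k
      · exact Submodule.neg_mem _ (hℓ k)
    · rintro _ (⟨k, rfl⟩ | ⟨k, rfl⟩)
      · rw [hpos k]
        exact Submodule.sub_mem _ (mem_affSpan_self (fun i => φ i ⊔ 0) _)
          (mem_affSpan_self (fun i => φ i ⊔ 0) _)
      · simp only [habs k]
        exact Submodule.add_mem _ (mem_affSpan_self (fun i => φ i ⊔ 0) _)
          (mem_affSpan_self (fun i => φ i ⊔ 0) _)
  -- The rectifier turns `1 - |ℓ k|` into the hat function and leaves `ℓ k + 1` unchanged, which is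
  -- nonnegative by `hlin`.
  let ψ : κ → unitCube n → ℝ := fun k => if hat k then 1 - |ℓ k| else ℓ k + 1
  refine h0.next (φ := ψ) (by omega) ?_ ?_
  · intro k
    have h1 : (1 : unitCube n → ℝ) ∈ Submodule.span ℝ
        (insert 1 (Set.range ℓ ∪ Set.range fun k => |ℓ k|)) :=
      Submodule.subset_span (Set.mem_insert _ _)
    by_cases hk : hat k
    · simp only [ψ, hk, if_true]
      exact Submodule.sub_mem _ h1 (Submodule.subset_span (Or.inr (Or.inr ⟨k, rfl⟩)))
    · simp only [ψ, hk, if_false]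
      exact Submodule.add_mem _ (Submodule.subset_span (Or.inr (Or.inl ⟨k, rfl⟩))) h1
  · rintro _ ⟨k, rfl⟩
    have hm := mem_affSpan_self (fun i => ψ i ⊔ 0) k
    by_cases hk : hat k
    · have : (fun x => ((if hat k then max (1 - |ℓ k x|) 0 else ℓ k x) + 1) / 2) =
          (1 / 2 : ℝ) • ((ψ k ⊔ 0) + 1) := by
        ext x
        simp [hk, ψ]
        ring
      simp only [this]
      exact Submodule.smul_mem _ _ (Submodule.add_mem _ hm (one_mem_affSpan _))
    · have : (fun x => ((if hat k then max (1 - |ℓ k x|) 0 else ℓ k x) + 1) / 2) =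
          (1 / 2 : ℝ) • (ψ k ⊔ 0) := by
        rw [sup_zero_of_nonneg]
        · ext x
          simp [hk, ψ]
          ring
        · intro x
          have := neg_le_of_abs_le (hlin k hk x)
          simp only [ψ, hk, if_false, Pi.add_apply, Pi.one_apply]
          linarith
      simp only [this]
      exact Submodule.smul_mem _ _ hm

end

/-! ### Local polynomial approximation in one variable -/

open Polynomial in
/-- A function whose `m`-th derivative oscillates by at most `ω` on an interval is approximated
there by a polynomial of degree at most `m`. -/
lemma exists_polynomial_near {a b ω : ℝ} (hab : a ≤ b) (m : ℕ) (G : ℕ → ℝ → ℝ)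
    (hG : ∀ j < m, ∀ t ∈ Set.Icc a b, HasDerivWithinAt (G j) (G (j + 1) t) (Set.Icc a b) t)
    (hosc : ∀ t ∈ Set.Icc a b, ∀ t' ∈ Set.Icc a b, |G m t - G m t'| ≤ ω) :
    ∃ p : ℝ[X], p.natDegree ≤ m ∧ ∀ t ∈ Set.Icc a b, |G 0 t - p.eval t| ≤ ω * (b - a) ^ m := by
  have ha : a ∈ Set.Icc a b := ⟨le_rfl, hab⟩
  induction m generalizing G with
  | zero => exact ⟨C (G 0 a), by simp, fun t ht => by simpa using hosc t ht a ha⟩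
  | succ m ih =>
    obtain ⟨q, hq, hqe⟩ := ih (fun j => G (j + 1)) (fun j hj => hG (j + 1) (by omega)) hosc
    obtain ⟨r, hr, hrd⟩ : ∃ r : ℝ[X], derivative r = q ∧ r.natDegree ≤ m + 1 := by
      refine ⟨∑ i ∈ Finset.range (m + 1), monomial (i + 1) (q.coeff i / (i + 1)), ?_, ?_⟩
      · rw [derivative_sum, q.as_sum_range' (m + 1) (by omega)]
        refine Finset.sum_congr rfl fun i hi => ?_
        rw [derivative_monomial, ← q.as_sum_range' (m + 1) (by omega)]
        congr 1
        push_cast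
        field_simp
      · refine natDegree_sum_le_of_forall_le _ _ fun i hi => (natDegree_monomial_le _).trans ?_
        have := Finset.mem_range.1 hi
        omega
    -- An antiderivative of the approximant of `G 1`, normalised to agree with `G 0` at `a`; the
    -- mean value inequality then costs one factor `b - a`.
    refine ⟨r + C (G 0 a - r.eval a), (natDegree_add_C).trans_le hrd, fun t ht => ?_⟩
    have hd : ∀ x ∈ Set.Icc a b, HasDerivWithinAt (fun x => G 0 x - r.eval x)
        (G 1 x - q.eval x) (Set.Icc a b) x := fun x hx => by
      have := (r.hasDerivAt x).hasDerivWithinAt (s := Set.Icc a b)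
      rw [hr] at this
      exact (hG 0 (by omega) x hx).sub this
    have hω : 0 ≤ ω := (abs_nonneg _).trans (hosc a ha a ha)
    have := (convex_Icc a b).norm_image_sub_le_of_norm_hasDerivWithin_le hd
      (fun x hx => hqe x hx) ha ht
    simp only [Real.norm_eq_abs] at this
    rw [eval_add, eval_C]
    calc _ = |G 0 t - r.eval t - (G 0 a - r.eval a)| := by congr 1; ring
      _ ≤ _ := this
      _ ≤ ω * (b - a) ^ m * (b - a) := by
        have h1 : |t - a| ≤ b - a := by rw [abs_of_nonneg] <;> linarith [ht.1, ht.2]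
        have h2 : 0 ≤ ω * (b - a) ^ m := mul_nonneg hω (pow_nonneg (by linarith) _)
        exact mul_le_mul_of_nonneg_left h1 h2
      _ = _ := by ring

/-! ### Hat functions, Lagrange interpolation and blending -/

/-- The hat function at `k / N`. -/
noncomputable def hatFn (N k : ℕ) (t : ℝ) : ℝ := max (1 - |(N : ℝ) * t - k|) 0

lemma hatFn_nonneg (N k : ℕ) (t : ℝ) : 0 ≤ hatFn N k t := le_max_right _ _

lemma sum_max_one_sub_abs (N : ℕ) {y : ℝ} (h0 : 0 ≤ y) (hN : y ≤ N) :
    ∑ k ∈ Finset.range (N + 1), max (1 - |y - k|) 0 = 1 := by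
  induction N with
  | zero =>
    have : y = 0 := le_antisymm (by simpa using hN) h0
    simp [this]
  | succ N ih =>
    rw [Finset.sum_range_succ]
    push_cast at hN ⊢
    rcases le_total y N with h | h
    · rw [ih h, max_eq_right, add_zero]
      rw [abs_of_nonpos (by linarith)]
      linarith
    · rw [Finset.sum_range_succ, Finset.sum_eq_zero]
      · rw [abs_of_nonneg (by linarith), abs_of_nonpos (by linarith), max_eq_left (by linarith),
          max_eq_left (by linarith)]
        ring
      · intro k hk
        have : (k : ℝ) + 1 ≤ N := by exact_mod_cast Finset.mem_range.1 hk
        rw [abs_of_nonneg (by linarith), max_eq_right (by linarith)]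

lemma sum_hatFn {N : ℕ} {t : ℝ} (ht : t ∈ Set.Icc (0 : ℝ) 1) :
    ∑ k : Fin (N + 1), hatFn N k t = 1 := by
  rw [Fin.sum_univ_eq_sum_range (fun k => hatFn N k t)]
  have hN : (0 : ℝ) ≤ N := by positivity
  exact sum_max_one_sub_abs N (mul_nonneg hN ht.1) (by nlinarith [ht.2])

/-- The interpolation nodes `j = 0, …, m` attached to the grid point `k / N`. -/
noncomputable def interpNode (N m k j : ℕ) : ℝ := ((min k (N - 1) : ℕ) + (j : ℝ) / (m + 1)) / N

section
variable {N m : ℕ}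

/-- The nodes lie in the cell to the right of `k / N`, or in the last cell when `k = N`; the
truncation `min k (N - 1)` keeps them in `[0, 1]`. -/
lemma interpNode_bounds (hN : 1 ≤ N) {k j : ℕ} (hk : k ≤ N) (hj : j ≤ m) :
    interpNode N m k j ∈ Set.Icc (0 : ℝ) 1 ∧ |N * interpNode N m k j - k| ≤ 1 := by
  have hN0 : (0 : ℝ) < N := by exact_mod_cast hN
  have hj0 : 0 ≤ (j : ℝ) / (m + 1) := by positivity
  have hj1 : (j : ℝ) / (m + 1) ≤ 1 := by
    rw [div_le_one (by positivity)]
    have : (j : ℝ) ≤ m := by exact_mod_cast hj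
    linarith
  have hmin : ((min k (N - 1) : ℕ) : ℝ) + 1 ≤ N := by
    have : min k (N - 1) + 1 ≤ N := by omega
    exact_mod_cast this
  refine ⟨⟨by unfold interpNode; positivity, ?_⟩, ?_⟩
  · unfold interpNode
    rw [div_le_one hN0]
    linarith
  · unfold interpNode
    rw [mul_div_cancel₀ _ hN0.ne']
    rcases (by omega : min k (N - 1) = k ∨ min k (N - 1) + 1 = k) with h | h
    · rw [h, abs_le]; constructor <;> linarith
    · have : ((min k (N - 1) : ℕ) : ℝ) + 1 = k := by exact_mod_cast h
      rw [abs_le]; constructor <;> linarith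

lemma one_le_abs_interpNode_sub (hN : 1 ≤ N) (k : ℕ) {i j : ℕ} (hij : i ≠ j) :
    1 / ((m + 1) * N) ≤ |interpNode N m k i - interpNode N m k j| := by
  have hN0 : (0 : ℝ) < N := by exact_mod_cast hN
  have : interpNode N m k i - interpNode N m k j = ((i : ℤ) - j : ℤ) / ((m + 1) * N) := by
    unfold interpNode
    push_cast
    field_simp
    ring
  rw [this, abs_div, abs_of_pos (by positivity : (0 : ℝ) < (m + 1) * N)]
  gcongr
  have h : (1 : ℤ) ≤ |(i : ℤ) - j| := Int.one_le_abs (sub_ne_zero.2 (by exact_mod_cast hij))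
  rw [← Int.cast_abs]
  exact_mod_cast h

/-- The Lagrange basis polynomials for the nodes at the grid point `k / N`. -/
noncomputable def lagrangeFn (N m k : ℕ) (j : Fin (m + 1)) (t : ℝ) : ℝ :=
  (Lagrange.basis Finset.univ (fun i : Fin (m + 1) => interpNode N m k i) j).eval t

lemma lagrangeFn_eq (N m k : ℕ) (j : Fin (m + 1)) (t : ℝ) :
    lagrangeFn N m k j t = ∏ i ∈ Finset.univ.erase j,
      (interpNode N m k j - interpNode N m k i)⁻¹ * (t - interpNode N m k i) := by
  simp [lagrangeFn, Lagrange.basis, Lagrange.basisDivisor, Polynomial.eval_prod]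

lemma interpNode_injective (hN : 1 ≤ N) (k : ℕ) :
    Function.Injective (fun i : Fin (m + 1) => interpNode N m k i) := by
  intro i j hij
  by_contra h
  have := one_le_abs_interpNode_sub (m := m) hN k (fun h' => h (Fin.ext h') : (i : ℕ) ≠ j)
  have h0 : interpNode N m k i - interpNode N m k j = 0 := sub_eq_zero.2 hij
  rw [h0, abs_zero] at this
  have hN0 : (0 : ℝ) < N := by exact_mod_cast hN
  exact absurd this (not_le.2 (by positivity))

lemma sum_eval_mul_lagrangeFn (hN : 1 ≤ N) (k : ℕ) {p : Polynomial ℝ} (hp : p.natDegree ≤ m)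
    (t : ℝ) : ∑ j : Fin (m + 1), p.eval (interpNode N m k j) * lagrangeFn N m k j t = p.eval t := by
  have hdeg : p.degree < (Finset.univ : Finset (Fin (m + 1))).card := by
    rw [Finset.card_fin]
    exact (Polynomial.degree_le_natDegree).trans_lt (by exact_mod_cast Nat.lt_succ_of_le hp)
  have := Lagrange.eq_interpolate (interpNode_injective (m := m) hN k).injOn hdeg
  conv_rhs => rw [this]
  simp [Lagrange.interpolate_apply, Polynomial.eval_finsetSum, lagrangeFn]

/-- Each of the `m` factors is a distance of at most `2 / N` divided by a node gap of at least `1 /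
((m + 1) * N)`. The mesh cancels, so the bound does not depend on `N`. -/
lemma abs_lagrangeFn_le (hN : 1 ≤ N) {k : ℕ} (hk : k ≤ N) (j : Fin (m + 1)) {t : ℝ}
    (ht : |N * t - k| ≤ 1) : |lagrangeFn N m k j t| ≤ (2 * (m + 1)) ^ m := by
  have hN0 : (0 : ℝ) < N := by exact_mod_cast hN
  rw [lagrangeFn_eq, Finset.abs_prod]
  have hcard : (Finset.univ.erase j).card = m := by simp
  refine (Finset.prod_le_prod (fun _ _ => abs_nonneg _) (g := fun _ => (2 * (m + 1) : ℝ))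
    fun i hi => ?_).trans_eq (by rw [Finset.prod_const, hcard])
  have h1 := one_le_abs_interpNode_sub (m := m) hN k
    (fun h' => Finset.ne_of_mem_erase hi (Fin.ext h').symm : (j : ℕ) ≠ i)
  have h2 : |t - interpNode N m k i| ≤ 2 / N := by
    rw [le_div_iff₀ hN0]
    have := (interpNode_bounds hN hk (Nat.le_of_lt_succ i.2)).2
    calc _ = |(t - interpNode N m k i) * N| := by rw [abs_mul, abs_of_pos hN0]
      _ = |(N * t - k) - (N * interpNode N m k i - k)| := by congr 1; ring
      _ ≤ 2 := (abs_sub _ _).trans (by linarith)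
  rw [abs_mul, abs_inv]
  calc _ ≤ (1 / (((m : ℝ) + 1) * N))⁻¹ * (2 / N) := by gcongr
    _ = 2 * ((m : ℝ) + 1) := by field_simp

/-- The functions of one variable used to reconstruct a function from its values at the nodes. -/
noncomputable def blendFn (N m : ℕ) (a : Fin (N + 1) × Fin (m + 1)) (t : ℝ) : ℝ :=
  hatFn N a.1 t * lagrangeFn N m a.1 a.2 t

/-- The node at which the coefficient of `blendFn` is evaluated. -/
noncomputable def blendNode (N m : ℕ) (a : Fin (N + 1) × Fin (m + 1)) : ℝ := interpNode N m a.1 a.2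

/-- A bound for the sum of the absolute values of all `blendFn`. -/
noncomputable def blendConst (m : ℕ) : ℝ := (m + 1) * (2 * (m + 1)) ^ m

lemma one_le_blendConst (m : ℕ) : 1 ≤ blendConst m := by
  unfold blendConst
  have : (0 : ℝ) ≤ m := by positivity
  exact one_le_mul_of_one_le_of_one_le (by linarith) (one_le_pow₀ (by linarith))

lemma blendNode_mem (hN : 1 ≤ N) (a : Fin (N + 1) × Fin (m + 1)) :
    blendNode N m a ∈ Set.Icc (0 : ℝ) 1 :=
  (interpNode_bounds hN (Nat.le_of_lt_succ a.1.2) (Nat.le_of_lt_succ a.2.2)).1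

lemma abs_lt_of_hatFn_ne_zero {k : ℕ} {t : ℝ} (h : hatFn N k t ≠ 0) : |(N : ℝ) * t - k| < 1 := by
  by_contra hc
  exact h (max_eq_right (by linarith))

lemma sum_abs_lagrangeFn_le (hN : 1 ≤ N) {k : ℕ} (hk : k ≤ N) {t : ℝ} (ht : |N * t - k| ≤ 1) :
    ∑ j : Fin (m + 1), |lagrangeFn N m k j t| ≤ blendConst m := by
  refine (Finset.sum_le_card_nsmul _ _ _ fun j _ => abs_lagrangeFn_le hN hk j ht).trans_eq ?_
  simp [blendConst]

lemma sum_abs_blendFn_le (hN : 1 ≤ N) {t : ℝ} (ht : t ∈ Set.Icc (0 : ℝ) 1) :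
    ∑ a : Fin (N + 1) × Fin (m + 1), |blendFn N m a t| ≤ blendConst m := by
  rw [Fintype.sum_prod_type]
  calc _ = ∑ k : Fin (N + 1), hatFn N k t * ∑ j : Fin (m + 1), |lagrangeFn N m k j t| := by
        simp only [blendFn, abs_mul, abs_of_nonneg (hatFn_nonneg _ _ _), Finset.mul_sum]
    _ ≤ ∑ k : Fin (N + 1), hatFn N k t * blendConst m := by
        refine Finset.sum_le_sum fun k _ => ?_
        by_cases h : hatFn N k t = 0
        · simp [h]
        · exact mul_le_mul_of_nonneg_left (sum_abs_lagrangeFn_le hN (Nat.le_of_lt_succ k.2)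
            (abs_lt_of_hatFn_ne_zero h).le) (hatFn_nonneg _ _ _)
    _ = _ := by rw [← Finset.sum_mul, sum_hatFn ht, one_mul]

/-- On subintervals of `[0, 1]` of length at most `h`, the function `g` is within `E` of a
polynomial of degree at most `m`. -/
def LocallyNearPolynomial (m : ℕ) (h E : ℝ) (g : ℝ → ℝ) : Prop :=
  ∀ a b : ℝ, 0 ≤ a → a ≤ b → b ≤ 1 → b - a ≤ h →
    ∃ p : Polynomial ℝ, p.natDegree ≤ m ∧ ∀ t ∈ Set.Icc a b, |g t - p.eval t| ≤ E

/-- Where the hat at `k / N` is nonzero, `t` and the nodes for `k` share an interval of length at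
most `2 / N`, on which `g` is near some `p`. Interpolation reproduces `p` and amplifies `g - p` by
at most `blendConst m`; the hats average these local errors. -/
lemma LocallyNearPolynomial.blend_error {g : ℝ → ℝ} {E : ℝ} (hN : 1 ≤ N)
    (hg : LocallyNearPolynomial m (2 / N) E g) {t : ℝ} (ht : t ∈ Set.Icc (0 : ℝ) 1) :
    |g t - ∑ a, g (blendNode N m a) * blendFn N m a t| ≤ (1 + blendConst m) * E := by
  have hN0 : (0 : ℝ) < N := by exact_mod_cast hN
  have key : ∀ k : Fin (N + 1), |hatFn N k t * (g t - ∑ j : Fin (m + 1),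
      g (interpNode N m k j) * lagrangeFn N m k j t)| ≤
      hatFn N k t * ((1 + blendConst m) * E) := by
    intro k
    by_cases h : hatFn N k t = 0
    · simp [h]
    rw [abs_mul, abs_of_nonneg (hatFn_nonneg _ _ _)]
    refine mul_le_mul_of_nonneg_left ?_ (hatFn_nonneg _ _ _)
    have hk := Nat.le_of_lt_succ k.2
    have hkt := (abs_lt_of_hatFn_ne_zero h).le
    -- The interval of radius `1 / N` about `k / N`, clipped to `[0, 1]`, where alone `g` is
    -- controlled.
    have hmem : ∀ u ∈ Set.Icc (0 : ℝ) 1, |N * u - (k : ℕ)| ≤ 1 →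
        u ∈ Set.Icc (max (0 : ℝ) (((k : ℕ) - 1) / N)) (min (1 : ℝ) (((k : ℕ) + 1) / N)) := by
      intro u hu hku
      obtain ⟨h1, h2⟩ := abs_le.1 hku
      refine ⟨max_le hu.1 ?_, le_min hu.2 ?_⟩
      · rw [div_le_iff₀ hN0]; linarith
      · rw [le_div_iff₀ hN0]; linarith
    have htI := hmem t ht hkt
    obtain ⟨p, hp, hpe⟩ := hg _ _ (le_max_left _ _) (htI.1.trans htI.2) (min_le_left _ _) (by
      calc _ ≤ (((k : ℕ) + 1) / N : ℝ) - ((k : ℕ) - 1) / N :=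
            sub_le_sub (min_le_right _ _) (le_max_right _ _)
        _ = 2 / N := by ring)
    have hE : 0 ≤ E := (abs_nonneg _).trans (hpe t htI)
    have hsum : g t - ∑ j : Fin (m + 1), g (interpNode N m k j) * lagrangeFn N m k j t =
        (g t - p.eval t) - ∑ j : Fin (m + 1),
          (g (interpNode N m k j) - p.eval (interpNode N m k j)) * lagrangeFn N m k j t := by
      simp only [sub_mul, Finset.sum_sub_distrib, sum_eval_mul_lagrangeFn hN k hp]
      ring
    rw [hsum, one_add_mul]
    refine (abs_sub _ _).trans (add_le_add (hpe t htI) ?_)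
    calc _ ≤ ∑ j : Fin (m + 1), E * |lagrangeFn N m k j t| := by
          refine (Finset.abs_sum_le_sum_abs _ _).trans (Finset.sum_le_sum fun j _ => ?_)
          rw [abs_mul]
          have := interpNode_bounds (m := m) hN hk (Nat.le_of_lt_succ j.2)
          exact mul_le_mul_of_nonneg_right (hpe _ (hmem _ this.1 this.2)) (abs_nonneg _)
      _ ≤ E * blendConst m := by
          rw [← Finset.mul_sum]
          exact mul_le_mul_of_nonneg_left (sum_abs_lagrangeFn_le hN hk hkt) hE
      _ = _ := mul_comm _ _
  have hdecomp : g t - ∑ a, g (blendNode N m a) * blendFn N m a t =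
      ∑ k : Fin (N + 1), hatFn N k t * (g t - ∑ j : Fin (m + 1),
        g (interpNode N m k j) * lagrangeFn N m k j t) := by
    rw [Fintype.sum_prod_type]
    simp only [mul_sub, Finset.sum_sub_distrib, ← Finset.sum_mul, sum_hatFn ht, one_mul]
    congr 1
    refine Finset.sum_congr rfl fun k _ => ?_
    rw [Finset.mul_sum]
    refine Finset.sum_congr rfl fun j _ => ?_
    simp only [blendNode, blendFn]
    ring
  rw [hdecomp]
  refine (Finset.abs_sum_le_sum_abs _ _).trans ((Finset.sum_le_sum fun k _ => key k).trans_eq ?_)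
  rw [← Finset.sum_mul, sum_hatFn ht, one_mul]

/-! ### Tensor product reconstruction -/

/-- Reconstruction in each variable separately gives reconstruction in all variables. -/
lemma tensor_blend_error (hN : 1 ≤ N) {E : ℝ} {n : ℕ} (f : (Fin n → ℝ) → ℝ)
    (hf : ∀ i, ∀ x ∈ unitCube n,
      |f x - ∑ a, f (Function.update x i (blendNode N m a)) * blendFn N m a (x i)| ≤ E)
    {x : Fin n → ℝ} (hx : x ∈ unitCube n) :
    |f x - ∑ a : Fin n → Fin (N + 1) × Fin (m + 1),
      f (fun i => blendNode N m (a i)) * ∏ i, blendFn N m (a i) (x i)| ≤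
        E * ∑ i ∈ Finset.range n, blendConst m ^ i := by
  induction n with
  | zero =>
    rw [Fintype.sum_unique, Finset.prod_of_isEmpty, mul_one, sub_eq_zero.2]
    · simp
    · exact congrArg f (Subsingleton.elim _ _)
  | succ n ih =>
    have hx0 : x 0 ∈ Set.Icc (0 : ℝ) 1 := ⟨hx.1 0, hx.2 0⟩
    have htail : Fin.tail x ∈ unitCube n := ⟨fun i => hx.1 i.succ, fun i => hx.2 i.succ⟩
    have hcons : ∀ a, ∀ y ∈ unitCube n,
        (Fin.cons (blendNode N m a) y : Fin (n + 1) → ℝ) ∈ unitCube (n + 1) := by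
      intro a y hy
      have := blendNode_mem (m := m) hN a
      refine ⟨fun i => ?_, fun i => ?_⟩
      · refine Fin.cases ?_ (fun i => ?_) i
        · simpa using this.1
        · simpa using hy.1 i
      · refine Fin.cases ?_ (fun i => ?_) i
        · simpa using this.2
        · simpa using hy.2 i
    have h1 := hf 0 x hx
    have h2 : ∀ a, |f (Function.update x 0 (blendNode N m a)) -
        ∑ b : Fin n → Fin (N + 1) × Fin (m + 1),
          f (Fin.cons (blendNode N m a) fun i => blendNode N m (b i)) *
            ∏ i, blendFn N m (b i) (x i.succ)| ≤
        E * ∑ i ∈ Finset.range n, blendConst m ^ i := by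
      intro a
      -- The first variable is frozen at a node; the slice inherits the one-variable estimates in
      -- the others.
      have := ih (fun y => f (Fin.cons (blendNode N m a) y)) (fun i y hy => by
        have := hf i.succ _ (hcons a y hy)
        simpa only [Fin.cons_succ, ← Fin.cons_update] using this) htail
      have hupd : Function.update x 0 (blendNode N m a) =
          Fin.cons (blendNode N m a) (Fin.tail x) := by
        conv_lhs => rw [← Fin.cons_self_tail x]
        rw [Fin.update_cons_zero]
      rw [hupd]
      exact this
    have hsplit : ∑ a : Fin (n + 1) → Fin (N + 1) × Fin (m + 1),
        f (fun i => blendNode N m (a i)) * ∏ i, blendFn N m (a i) (x i) =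
        ∑ a, (∑ b : Fin n → Fin (N + 1) × Fin (m + 1),
          f (Fin.cons (blendNode N m a) fun i => blendNode N m (b i)) *
            ∏ i, blendFn N m (b i) (x i.succ)) * blendFn N m a (x 0) := by
      rw [← (Fin.consEquiv fun _ => Fin (N + 1) × Fin (m + 1)).sum_comp, Fintype.sum_prod_type]
      refine Finset.sum_congr rfl fun a _ => ?_
      rw [Finset.sum_mul]
      refine Finset.sum_congr rfl fun b _ => ?_
      have : (fun i => blendNode N m ((Fin.cons a b : Fin (n + 1) → Fin (N + 1) × Fin (m + 1)) i)) =
          (Fin.cons (blendNode N m a) fun i => blendNode N m (b i) : Fin (n + 1) → ℝ) := by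
        ext i
        refine Fin.cases ?_ (fun i => ?_) i <;> simp
      simp only [Fin.consEquiv_apply, this, Fin.prod_univ_succ, Fin.cons_zero, Fin.cons_succ]
      ring
    have hΛ := sum_abs_blendFn_le (m := m) hN hx0
    set S := ∑ i ∈ Finset.range n, blendConst m ^ i
    have hES : 0 ≤ E * S := (abs_nonneg _).trans (h2 (0, 0))
    rw [hsplit, Finset.sum_range_succ', pow_zero, mul_add, mul_one]
    simp only [pow_succ, ← Finset.sum_mul]
    -- Replacing `f` by its reconstruction in variable `0` costs `E`; replacing the slices by theirs
    -- costs the `n`-variable error times the bound on `∑ |blendFn|`.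
    calc _ = |(∑ a, (f (Function.update x 0 (blendNode N m a)) -
            ∑ b : Fin n → Fin (N + 1) × Fin (m + 1),
            f (Fin.cons (blendNode N m a) fun i => blendNode N m (b i)) *
            ∏ i, blendFn N m (b i) (x i.succ)) * blendFn N m a (x 0)) +
          (f x - ∑ a, f (Function.update x 0 (blendNode N m a)) * blendFn N m a (x 0))| := by
          simp only [sub_mul, Finset.sum_sub_distrib]
          congr 1
          ring
      _ ≤ ∑ a, (E * S) * |blendFn N m a (x 0)| + E := by
          refine (abs_add_le _ _).trans (add_le_add ?_ h1)
          refine (Finset.abs_sum_le_sum_abs _ _).trans (Finset.sum_le_sum fun a _ => ?_)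
          rw [abs_mul]
          exact mul_le_mul_of_nonneg_right (h2 a) (abs_nonneg _)
      _ ≤ (E * S) * blendConst m + E := by
          rw [← Finset.mul_sum]
          gcongr
      _ = _ := by ring

end

/-! ### Hölder functions -/

section
variable {n : ℕ} {α B : ℝ} {f : (Fin n → ℝ) → ℝ}

lemma zero_mem_unitCube : (0 : Fin n → ℝ) ∈ unitCube n := ⟨le_rfl, fun _ => zero_le_one⟩

lemma update_mem_unitCube {x : Fin n → ℝ} (hx : x ∈ unitCube n) (i : Fin n) {t : ℝ}
    (ht : t ∈ Set.Icc (0 : ℝ) 1) : Function.update x i t ∈ unitCube n := by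
  refine ⟨fun j => ?_, fun j => ?_⟩ <;> rcases eq_or_ne j i with rfl | h
  · simpa using ht.1
  · simpa [h] using hx.1 j
  · simpa using ht.2
  · simpa [h] using hx.2 j

lemma norm_le_one_of_mem_unitCube {x : Fin n → ℝ} (hx : x ∈ unitCube n) : ‖x‖ ≤ 1 := by
  refine (pi_norm_le_iff_of_nonneg zero_le_one).2 fun i => ?_
  rw [Real.norm_eq_abs, abs_of_nonneg (hx.1 i)]
  exact hx.2 i

lemma holderBall.abs_iterPartial_le (hB : 0 ≤ B) (hf : f ∈ holderBall n α B) {l : List (Fin n)}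
    (hl : l.length < ⌊α⌋₊) {x : Fin n → ℝ} (hx : x ∈ unitCube n) :
    |cubeIterPartial l f x| ≤ B := by
  rw [← ENNReal.ofReal_le_ofReal_iff hB]
  refine le_trans ?_ hf.2.2
  refine le_trans ?_ le_self_add
  exact le_iSup₂_of_le l hl (le_iSup₂_of_le x hx le_rfl)

lemma holderBall.abs_iterPartial_sub_le (hB : 0 ≤ B) (hf : f ∈ holderBall n α B)
    {l : List (Fin n)} (hl : l.length = ⌊α⌋₊) {x x' : Fin n → ℝ} (hx : x ∈ unitCube n)
    (hx' : x' ∈ unitCube n) :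
    |cubeIterPartial l f x - cubeIterPartial l f x'| ≤ B * ‖x - x'‖ ^ (α - (⌊α⌋₊ : ℝ)) := by
  rcases eq_or_ne x x' with rfl | h
  · rw [sub_self, abs_zero]
    positivity
  have hpos : 0 < ‖x - x'‖ ^ (α - (⌊α⌋₊ : ℝ)) :=
    Real.rpow_pos_of_pos (norm_pos_iff.2 (sub_ne_zero.2 h)) _
  rw [← div_le_iff₀ hpos, ← ENNReal.ofReal_le_ofReal_iff hB]
  refine le_trans ?_ hf.2.2
  refine le_trans ?_ le_add_self
  exact le_iSup₂_of_le l hl (le_iSup₂_of_le x hx (le_iSup₂_of_le x' hx' (le_iSup_of_le h le_rfl)))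

/-- When `⌊α⌋ = 0` the norm controls oscillation but not size, so only `f - f 0` has a bound in
terms of `B`; the constant `f 0` later goes into the output bias. -/
lemma holderBall.abs_sub_zero_le (hα : 0 < α) (hB : 0 ≤ B) (hf : f ∈ holderBall n α B)
    {x : Fin n → ℝ} (hx : x ∈ unitCube n) : |f x - f 0| ≤ 2 * B := by
  rcases Nat.eq_zero_or_pos ⌊α⌋₊ with h | h
  · have := holderBall.abs_iterPartial_sub_le hB hf (l := []) (by simp [h]) hx zero_mem_unitCube
    simp only [cubeIterPartial, List.foldr_nil, h, Nat.cast_zero, sub_zero] at this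
    have h1 : ‖x‖ ^ α ≤ 1 :=
      Real.rpow_le_one (norm_nonneg _) (norm_le_one_of_mem_unitCube hx) hα.le
    nlinarith
  · have h1 := holderBall.abs_iterPartial_le hB hf (l := []) h hx
    have h2 := holderBall.abs_iterPartial_le hB hf (l := []) h zero_mem_unitCube
    simp only [cubeIterPartial, List.foldr_nil] at h1 h2
    linarith [abs_sub (f x) (f 0)]

lemma HasCubePartials.hasDerivWithinAt {m : ℕ} (hf : HasCubePartials m f) {l : List (Fin n)}
    (hl : l.length < m) (i : Fin n) {x : Fin n → ℝ} (hx : x ∈ unitCube n) {t : ℝ}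
    (ht : t ∈ Set.Icc (0 : ℝ) 1) :
    HasDerivWithinAt (fun t => cubeIterPartial l f (Function.update x i t))
      (cubeIterPartial (i :: l) f (Function.update x i t)) (Set.Icc 0 1) t := by
  have h := (hf l hl i _ (update_mem_unitCube hx i ht)).hasDerivWithinAt
  have hs : coordSlice i (cubeIterPartial l f) (Function.update x i t) =
      fun t => cubeIterPartial l f (Function.update x i t) := by
    ext u
    simp [coordSlice]
  have hd : cubeIterPartial (i :: l) f (Function.update x i t) = derivWithin
      (coordSlice i (cubeIterPartial l f) (Function.update x i t)) (Set.Icc 0 1)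
      (Function.update x i t i) := rfl
  rw [hd]
  rw [Function.update_self] at h ⊢
  rwa [hs] at h ⊢

/-- Only the pure derivatives in direction `i` are needed: the one of order `⌊α⌋` oscillates by at
most `B * h ^ (α - ⌊α⌋)`, and integrating back supplies `h ^ ⌊α⌋`. -/
lemma holderBall.locallyNearPolynomial (hα : 0 < α) (hB : 0 ≤ B) (hf : f ∈ holderBall n α B)
    {h : ℝ} (hh : 0 < h) (i : Fin n) {x : Fin n → ℝ} (hx : x ∈ unitCube n) (c : ℝ) :
    LocallyNearPolynomial ⌊α⌋₊ h (B * h ^ α) (fun t => f (Function.update x i t) - c) := by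
  intro a b ha hab hb hlen
  have hsub : Set.Icc a b ⊆ Set.Icc 0 1 := Set.Icc_subset_Icc ha hb
  have hs : 0 ≤ α - (⌊α⌋₊ : ℝ) := sub_nonneg.2 (Nat.floor_le hα.le)
  obtain ⟨p, hp, hpe⟩ := exists_polynomial_near (ω := B * h ^ (α - (⌊α⌋₊ : ℝ))) hab ⌊α⌋₊
    (fun j t => cubeIterPartial (List.replicate j i) f (Function.update x i t))
    (fun j hj t ht => (hf.2.1.hasDerivWithinAt (by simpa using hj) i hx (hsub ht)).mono hsub)
    (fun t ht t' ht' => by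
      refine (holderBall.abs_iterPartial_sub_le hB hf (by simp)
        (update_mem_unitCube hx i (hsub ht)) (update_mem_unitCube hx i (hsub ht'))).trans ?_
      refine mul_le_mul_of_nonneg_left (Real.rpow_le_rpow (norm_nonneg _) ?_ hs) hB
      refine (pi_norm_le_iff_of_nonneg hh.le).2 fun j => ?_
      rcases eq_or_ne j i with rfl | hj
      · simp only [Pi.sub_apply, Function.update_self, Real.norm_eq_abs]
        rw [abs_le]
        constructor <;> linarith [ht.1, ht.2, ht'.1, ht'.2]
      · simp [hj, hh.le])
  refine ⟨p - Polynomial.C c, (Polynomial.natDegree_sub_C).trans_le hp, fun t ht => ?_⟩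
  rw [Polynomial.eval_sub, Polynomial.eval_C, sub_sub_sub_cancel_right]
  refine (hpe t ht).trans ?_
  calc _ ≤ B * h ^ (α - (⌊α⌋₊ : ℝ)) * h ^ ⌊α⌋₊ := by
        have : 0 ≤ b - a := by linarith
        gcongr
    _ = B * h ^ α := by
        rw [mul_assoc, ← Real.rpow_natCast h, ← Real.rpow_add hh, sub_add_cancel]

/-- Approximation of Hölder functions by combinations of products of `blendFn`s. -/
lemma holderBall.exists_blend (hα : 0 < α) (hB : 0 ≤ B) (hf : f ∈ holderBall n α B) {N : ℕ}
    (hN : 1 ≤ N) : ∃ c : (Fin n → Fin (N + 1) × Fin (⌊α⌋₊ + 1)) → ℝ, (∀ a, |c a| ≤ 2 * B) ∧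
      ∀ x ∈ unitCube n, |f x - f 0 - ∑ a, c a * ∏ i, blendFn N ⌊α⌋₊ (a i) (x i)| ≤
        (1 + blendConst ⌊α⌋₊) * (B * (2 / N) ^ α) *
          ∑ i ∈ Finset.range n, blendConst ⌊α⌋₊ ^ i := by
  have hN0 : (0 : ℝ) < N := by exact_mod_cast hN
  refine ⟨fun a => f (fun i => blendNode N ⌊α⌋₊ (a i)) - f 0, fun a => ?_, fun x hx => ?_⟩
  · exact holderBall.abs_sub_zero_le hα hB hf
      ⟨fun i => (blendNode_mem hN (a i)).1, fun i => (blendNode_mem hN (a i)).2⟩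
  · refine tensor_blend_error hN (fun x => f x - f 0) (fun i x hx => ?_) hx
    have := (holderBall.locallyNearPolynomial hα hB hf (h := 2 / N) (by positivity) i hx
      (f 0)).blend_error hN (t := x i) ⟨hx.1 i, hx.2 i⟩
    simpa using this

end

/-! ### Networks for the blending functions -/

section
variable {n N m : ℕ}

/-- The factors of `blendFn`, up to a constant. -/
noncomputable def blendFactor (N m : ℕ) (a : Fin (N + 1) × Fin (m + 1)) (j : Fin (m + 1)) (t : ℝ) :
    ℝ :=
  if j = a.2 then hatFn N a.1 t else t - interpNode N m a.1 j

/-- The constant factor of `blendFn`. -/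
noncomputable def blendScale (N m : ℕ) (a : Fin (N + 1) × Fin (m + 1)) : ℝ :=
  ∏ i ∈ Finset.univ.erase a.2, (interpNode N m a.1 a.2 - interpNode N m a.1 i)⁻¹

lemma blendFn_eq (a : Fin (N + 1) × Fin (m + 1)) (t : ℝ) :
    blendFn N m a t = blendScale N m a * ∏ j, blendFactor N m a j t := by
  rw [← Finset.mul_prod_erase Finset.univ (fun j => blendFactor N m a j t) (Finset.mem_univ a.2)]
  have : ∏ j ∈ Finset.univ.erase a.2, blendFactor N m a j t =
      ∏ j ∈ Finset.univ.erase a.2, (t - interpNode N m a.1 j) :=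
    Finset.prod_congr rfl fun j hj => by simp [blendFactor, Finset.ne_of_mem_erase hj]
  rw [this, blendFn, lagrangeFn_eq, Finset.prod_mul_distrib]
  simp only [blendFactor, blendScale, if_true]
  ring

lemma abs_blendScale_le (hN : 1 ≤ N) (a : Fin (N + 1) × Fin (m + 1)) :
    |blendScale N m a| ≤ ((m + 1) * N) ^ m := by
  have hN0 : (0 : ℝ) < N := by exact_mod_cast hN
  unfold blendScale
  rw [Finset.abs_prod]
  refine (Finset.prod_le_prod (fun _ _ => abs_nonneg _) (g := fun _ => ((m + 1) * N : ℝ))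
    fun i hi => ?_).trans_eq (by rw [Finset.prod_const]; simp)
  have h1 := one_le_abs_interpNode_sub (m := m) hN a.1
    (fun h' => Finset.ne_of_mem_erase hi (Fin.ext h').symm : (a.2 : ℕ) ≠ i)
  rw [abs_inv]
  calc _ ≤ (1 / (((m : ℝ) + 1) * N))⁻¹ := by gcongr
    _ = _ := by rw [one_div, inv_inv]

/-- After the constants `blendScale` are pulled out, the `n * (m + 1)` remaining factors are hats or
affine functions with values in `[-1, 1]`, as the product network requires. The constants amplify
its error by a power of `N`, harmless against `4 ^ s`. -/
lemma exists_computes_blend (hN : 1 ≤ N) (a : Fin n → Fin (N + 1) × Fin (m + 1)) (s : ℕ) :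
    ∃ p : unitCube n → ℝ,
      Computes n (2 * (n * (m + 1)) + 9) (1 + n * (m + 1) * (s + 2)) {p} ∧
      ∀ x, |p x - ∏ i, blendFn N m (a i) (x.1 i)| ≤
        ((m + 1) * N) ^ (m * n) * (n * (m + 1) * (3 * (1 / 4 ^ s))) := by
  have hN0 : (0 : ℝ) < N := by exact_mod_cast hN
  let ℓ : Fin n × Fin (m + 1) → unitCube n → ℝ := fun k x =>
    if k.2 = (a k.1).2 then N * x.1 k.1 - (a k.1).1 else x.1 k.1 - interpNode N m (a k.1).1 k.2
  have hℓ : ∀ k, ℓ k ∈ affSpan (cubeCoord n) := by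
    intro k
    have h1 := mem_affSpan_self (cubeCoord n) k.1
    have h2 := one_mem_affSpan (cubeCoord n)
    by_cases hk : k.2 = (a k.1).2
    · have : ℓ k = (N : ℝ) • cubeCoord n k.1 - ((a k.1).1 : ℝ) • 1 := by
        ext x; simp [ℓ, hk, cubeCoord]
      rw [this]
      exact Submodule.sub_mem _ (Submodule.smul_mem _ _ h1) (Submodule.smul_mem _ _ h2)
    · have : ℓ k = cubeCoord n k.1 - (interpNode N m (a k.1).1 k.2) • 1 := by
        ext x; simp [ℓ, hk, cubeCoord]
      rw [this]
      exact Submodule.sub_mem _ h1 (Submodule.smul_mem _ _ h2)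
  have hlin : ∀ k, ¬ k.2 = (a k.1).2 → ∀ x, |ℓ k x| ≤ 1 := by
    intro k hk x
    have h1 := (interpNode_bounds (m := m) hN (Nat.le_of_lt_succ (a k.1).1.2)
      (Nat.le_of_lt_succ k.2.2)).1
    have h2 := x.2.1 k.1
    have h3 := x.2.2 k.1
    simp only [Pi.zero_apply, Pi.one_apply] at h2 h3
    simp only [ℓ, hk, if_false]
    rw [abs_le]
    constructor <;> linarith [h1.1, h1.2]
  have hcard : Fintype.card (Fin n × Fin (m + 1)) = n * (m + 1) := by simp
  have hfac : ∀ k x, (if k.2 = (a k.1).2 then max (1 - |ℓ k x|) 0 else ℓ k x) =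
      blendFactor N m (a k.1) k.2 (x.1 k.1) := by
    intro k x
    by_cases hk : k.2 = (a k.1).2 <;> simp [blendFactor, ℓ, hk, hatFn]
  have hbd : ∀ k x, |if k.2 = (a k.1).2 then max (1 - |ℓ k x|) 0 else ℓ k x| ≤ 1 := by
    intro k x
    by_cases hk : k.2 = (a k.1).2
    · rw [if_pos hk, abs_of_nonneg (le_max_right _ _)]
      exact max_le (by linarith [abs_nonneg (ℓ k x)]) zero_le_one
    · rw [if_neg hk]
      exact hlin k hk x
  have hc := computes_factors (w := 2 * (n * (m + 1)) + 9) (by omega) hℓ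
    (hat := fun k => k.2 = (a k.1).2) hlin
  obtain ⟨p, hp, hpe⟩ := exists_computes_prod (by omega) (fun k x => by
    have := abs_le.1 (hbd k x)
    exact ⟨by linarith, by linarith⟩) hc s
  have hprod : ∀ x : unitCube n, ∏ i, blendFn N m (a i) (x.1 i) = (∏ i, blendScale N m (a i)) *
      ∏ k : Fin n × Fin (m + 1), blendFactor N m (a k.1) k.2 (x.1 k.1) := by
    intro x
    rw [Fintype.prod_prod_type, ← Finset.prod_mul_distrib]
    exact Finset.prod_congr rfl fun i _ => blendFn_eq _ _
  refine ⟨(∏ i, blendScale N m (a i)) • p, ?_, fun x => ?_⟩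
  · rw [hcard] at hp
    refine hp.of_subset ?_
    rw [Set.singleton_subset_iff]
    exact Submodule.smul_mem _ _ (Submodule.subset_span (by simp))
  · have h1 := hpe x
    simp only [mul_div_cancel₀ _ (two_ne_zero' ℝ), add_sub_cancel_right, hfac, hcard] at h1
    rw [hprod, Pi.smul_apply, smul_eq_mul, ← mul_sub, abs_mul]
    push_cast at h1
    refine mul_le_mul ?_ h1 (abs_nonneg _) (by positivity)
    rw [Finset.abs_prod]
    refine (Finset.prod_le_prod (fun _ _ => abs_nonneg _) (g := fun _ => (((m + 1) * N) ^ m : ℝ))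
      fun i _ => abs_blendScale_le hN (a i)).trans_eq ?_
    rw [Finset.prod_const, Finset.card_fin, pow_mul]

end

/-! ### Choice of grid size and depth -/

lemma tendsto_log_one_div_atTop : Tendsto (fun ε : ℝ => Real.log (1 / ε)) (𝓝[>] 0) atTop := by
  simp only [one_div]
  exact Real.tendsto_log_atTop.comp tendsto_inv_nhdsGT_zero

lemma isBigO_const_log (c : ℝ) :
    (fun _ : ℝ => c) =O[𝓝[>] 0] (fun ε : ℝ => Real.log (1 / ε)) :=
  ((isLittleO_const_left.2 (Or.inr (tendsto_norm_atTop_atTop.comp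
    tendsto_log_one_div_atTop))).isBigO)

/-- The grid size and the depth which make both error terms at most `ε / 2`. -/
lemma exists_grid_depth {α C₁ C₂ : ℝ} (hα : 0 < α) (hC₁ : 0 < C₁) (hC₂ : 0 < C₂) (r : ℕ) :
    ∃ N s : ℝ → ℕ, (∀ ε, 0 < ε → 1 ≤ N ε ∧ C₁ * (2 / (N ε : ℝ)) ^ α ≤ ε / 2 ∧
        C₂ * ((N ε : ℝ) + 1) ^ r * (1 / 4 ^ s ε) ≤ ε / 2) ∧
      (fun ε : ℝ => (N ε : ℝ) + 1) =O[𝓝[>] 0] (fun ε : ℝ => ε ^ (-1 / α)) ∧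
      (fun ε : ℝ => (s ε : ℝ)) =O[𝓝[>] 0] (fun ε : ℝ => Real.log (1 / ε)) := by
  -- The argument of the ceiling solves `C₁ * (2 / N) ^ α = ε / 2`; the added `1` gives `1 ≤ N ε`.
  let N : ℝ → ℕ := fun ε => ⌈2 * (2 * C₁ / ε) ^ (1 / α)⌉₊ + 1
  let X : ℝ → ℝ := fun ε => 2 * C₂ * ((N ε : ℝ) + 1) ^ r / ε
  -- Since `4 > exp 1`, this gives `4 ^ s ε ≥ X ε`; if the logarithm is negative, `s ε = 0`
  -- suffices.
  let s : ℝ → ℕ := fun ε => ⌈Real.log (X ε)⌉₊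
  let c : ℝ := 2 * (2 * C₁) ^ (1 / α) + 3
  have hc : 0 < c := by positivity
  have hNle : ∀ ε, 0 < ε → ε < 1 → (N ε : ℝ) + 1 ≤ c * ε ^ (-1 / α) := by
    intro ε h0 h1
    have h2 : (N ε : ℝ) ≤ 2 * (2 * C₁ / ε) ^ (1 / α) + 1 + 1 := by
      simp only [N, Nat.cast_add, Nat.cast_one]
      have := (Nat.ceil_lt_add_one (a := 2 * (2 * C₁ / ε) ^ (1 / α)) (by positivity)).le
      linarith
    have h3 : (2 * C₁ / ε) ^ (1 / α) = (2 * C₁) ^ (1 / α) * ε ^ (-1 / α) := by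
      rw [Real.div_rpow (by positivity) h0.le, neg_div, Real.rpow_neg h0.le, div_eq_mul_inv]
    have h4 : 1 ≤ ε ^ (-1 / α) :=
      Real.one_le_rpow_of_pos_of_le_one_of_nonpos h0 h1.le
        (div_nonpos_of_nonpos_of_nonneg (by norm_num) hα.le)
    calc (N ε : ℝ) + 1 ≤ 2 * ((2 * C₁) ^ (1 / α) * ε ^ (-1 / α)) + 3 * 1 := by
          rw [← h3]; linarith
      _ ≤ 2 * ((2 * C₁) ^ (1 / α) * ε ^ (-1 / α)) + 3 * ε ^ (-1 / α) := by gcongr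
      _ = _ := by simp only [c]; ring
  have hev : ∀ᶠ ε : ℝ in 𝓝[>] 0, 0 < ε ∧ ε < 1 := Ioo_mem_nhdsGT zero_lt_one
  refine ⟨N, s, fun ε hε => ⟨by simp [N], ?_, ?_⟩, ?_, ?_⟩
  · have hN : 2 * (2 * C₁ / ε) ^ (1 / α) ≤ N ε := by
      simp only [N, Nat.cast_add, Nat.cast_one]
      linarith [Nat.le_ceil (2 * (2 * C₁ / ε) ^ (1 / α))]
    have hN0 : (0 : ℝ) < N ε := by simp only [N]; positivity
    have h1 : 2 / (N ε : ℝ) ≤ (ε / (2 * C₁)) ^ (1 / α) := by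
      rw [← inv_div (2 * C₁) ε, Real.inv_rpow (by positivity), div_le_iff₀ hN0, inv_mul_eq_div,
        le_div_iff₀ (by positivity)]
      exact hN
    calc C₁ * (2 / (N ε : ℝ)) ^ α ≤ C₁ * ((ε / (2 * C₁)) ^ (1 / α)) ^ α := by gcongr
      _ = ε / 2 := by
        rw [← Real.rpow_mul (by positivity), one_div_mul_cancel hα.ne', Real.rpow_one]
        field_simp
  · have hX : 0 < X ε := by positivity
    have h1 : X ε ≤ 4 ^ s ε := by
      calc X ε = Real.exp (Real.log (X ε)) := (Real.exp_log hX).symm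
        _ ≤ Real.exp (s ε) := Real.exp_le_exp.2 (Nat.le_ceil _)
        _ = Real.exp 1 ^ s ε := by rw [← Real.exp_nat_mul, mul_one]
        _ ≤ 4 ^ s ε := by
          gcongr
          linarith [Real.exp_one_lt_d9]
    rw [mul_one_div, div_le_iff₀ (by positivity)]
    rw [div_le_iff₀ hε] at h1
    linarith
  · refine IsBigO.of_bound c ?_
    filter_upwards [hev] with ε hε
    rw [Real.norm_of_nonneg (by positivity), Real.norm_of_nonneg (Real.rpow_nonneg hε.1.le _)]
    exact hNle ε hε.1 hε.2
  · have hmain : (fun ε : ℝ => (s ε : ℝ)) =O[𝓝[>] 0] (fun ε : ℝ =>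
        (|Real.log (2 * C₂)| + r * |Real.log c| + 1) + (r / α + 1) * Real.log (1 / ε)) := by
      refine IsBigO.of_bound 1 ?_
      filter_upwards [hev] with ε hε
      have hlog : 0 ≤ Real.log (1 / ε) := Real.log_nonneg (by
        rw [le_div_iff₀ hε.1]; linarith [hε.2])
      have hM : 0 < (N ε : ℝ) + 1 := by positivity
      have h1 : Real.log (X ε) =
          Real.log (2 * C₂) + r * Real.log ((N ε : ℝ) + 1) + Real.log (1 / ε) := by
        simp only [X]
        rw [div_eq_mul_one_div, Real.log_mul (by positivity) (one_div_pos.2 hε.1).ne',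
          Real.log_mul (by positivity) (by positivity), Real.log_pow]
      have h2 : Real.log ((N ε : ℝ) + 1) ≤ |Real.log c| + 1 / α * Real.log (1 / ε) := by
        refine (Real.log_le_log hM (hNle ε hε.1 hε.2)).trans ?_
        rw [Real.log_mul hc.ne' (Real.rpow_pos_of_pos hε.1 _).ne', Real.log_rpow hε.1,
          one_div ε, Real.log_inv]
        have := le_abs_self (Real.log c)
        have e : -1 / α * Real.log ε = 1 / α * -Real.log ε := by ring
        linarith
      have h3 : Real.log (X ε) ≤ |Real.log (2 * C₂)| + r * |Real.log c| +
          (r / α + 1) * Real.log (1 / ε) := by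
        rw [h1]
        have e1 := le_abs_self (Real.log (2 * C₂))
        have e2 := mul_le_mul_of_nonneg_left h2 (Nat.cast_nonneg (α := ℝ) r)
        have e3 : (r : ℝ) * (|Real.log c| + 1 / α * Real.log (1 / ε)) =
            r * |Real.log c| + r / α * Real.log (1 / ε) := by ring
        linarith
      have hnn : 0 ≤ |Real.log (2 * C₂)| + r * |Real.log c| +
          (r / α + 1) * Real.log (1 / ε) := by positivity
      rw [one_mul, Real.norm_of_nonneg (by positivity), Real.norm_of_nonneg (by positivity)]
      calc (s ε : ℝ) ≤ (⌈|Real.log (2 * C₂)| + r * |Real.log c| +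
            (r / α + 1) * Real.log (1 / ε)⌉₊ : ℝ) := by
            exact_mod_cast Nat.ceil_mono h3
        _ ≤ _ := (Nat.ceil_lt_add_one hnn).le
        _ = _ := by ring
    exact hmain.trans ((isBigO_const_log _).add ((isBigO_refl _ _).const_mul_left _))

/-! ### Averaging over the group -/

lemma permAct_mul {n : ℕ} (σ τ : Equiv.Perm (Fin n)) (x : Fin n → ℝ) :
    permAct (σ * τ) x = permAct σ (permAct τ x) := by
  ext i
  simp [permAct]

section
variable {n : ℕ} (G : Subgroup (Equiv.Perm (Fin n))) [Fintype G]

/-- The average of `Φ` over `G`. -/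
noncomputable def groupAverage (Φ : (Fin n → ℝ) → (Fin n → ℝ)) (x : Fin n → ℝ) (i : Fin n) : ℝ :=
  (Fintype.card G : ℝ)⁻¹ * ∑ σ : G, Φ (permAct σ.1 x) (σ.1 i)

lemma groupAverage_permAct (Φ : (Fin n → ℝ) → (Fin n → ℝ)) {τ : Equiv.Perm (Fin n)} (hτ : τ ∈ G)
    (x : Fin n → ℝ) : groupAverage G Φ (permAct τ x) = permAct τ (groupAverage G Φ x) := by
  ext i
  simp only [permAct, groupAverage]
  congr 1
  -- Reindexing the sum by `σ ↦ σ * τ`.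
  rw [← Equiv.sum_comp (Equiv.mulRight (⟨τ, hτ⟩ : G))
    (fun σ : G => Φ (permAct σ.1 x) (σ.1 (τ⁻¹ i)))]
  refine Finset.sum_congr rfl fun σ _ => ?_
  simp only [Equiv.coe_mulRight, Subgroup.coe_mul, permAct_mul, Equiv.Perm.mul_apply,
    show τ (τ⁻¹ i) = i from τ.apply_symm_apply i]

/-- By equivariance `F x i` equals coordinate `σ i` of `F` at `permAct σ x` for every `σ`, so the
error is an average of errors of `Φ`. -/
lemma abs_groupAverage_sub_le {F Φ : (Fin n → ℝ) → (Fin n → ℝ)} (hF : IsCubeEquivariant G F)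
    {ε : ℝ} (hΦ : ∀ x ∈ unitCube n, ∀ i, |Φ x i - F x i| ≤ ε) {x : Fin n → ℝ}
    (hx : x ∈ unitCube n) (i : Fin n) : |groupAverage G Φ x i - F x i| ≤ ε := by
  have hG : (0 : ℝ) < Fintype.card G := by exact_mod_cast Fintype.card_pos
  have h : groupAverage G Φ x i - F x i = (Fintype.card G : ℝ)⁻¹ *
      ∑ σ : G, (Φ (permAct σ.1 x) (σ.1 i) - F (permAct σ.1 x) (σ.1 i)) := by
    have h1 : ∀ σ : G, F (permAct σ.1 x) (σ.1 i) = F x i := fun σ => by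
      rw [hF σ.1 σ.2 x hx]
      simp [permAct]
    simp only [h1, Finset.sum_sub_distrib, groupAverage, mul_sub]
    simp [hG.ne']
  rw [h, abs_mul, abs_of_pos (inv_pos.2 hG), inv_mul_le_iff₀ hG]
  refine (Finset.abs_sum_le_sum_abs _ _).trans ((Finset.sum_le_card_nsmul _ _ ε fun σ _ =>
    hΦ _ (permAct_mem_unitCube _ hx) _).trans_eq ?_)
  simp

end

/-! ### Assembly of the equivariant network -/

/-- Networks for a given grid size `N` and depth parameter `s`. -/
lemma exists_equivariant_net {n : ℕ} {α B : ℝ} (hα : 0 < α) (hB : 0 < B) {m : ℕ} (hm : m = ⌊α⌋₊)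
    {N : ℕ} (hN : 1 ≤ N) (s : ℕ) (G : Subgroup (Equiv.Perm (Fin n)))
    {F : (Fin n → ℝ) → (Fin n → ℝ)} (hG : IsCubeEquivariant G F)
    (hF : ∀ i, (fun x => F x i) ∈ holderBall n α B) :
    ∃ Net : ReLUNet n n, IsCubeEquivariant G Net.eval ∧
      Net.numLayers = n * (m + 1) * (s + 2) + 3 ∧
      Net.numParams ≤ n.factorial * ((N + 1) * (m + 1)) ^ n *
        ((2 * (n * (m + 1)) + 9) * (n + 1) + (1 + n * (m + 1) * (s + 2)) *
          ((2 * (n * (m + 1)) + 9) * ((2 * (n * (m + 1)) + 9) + 1)) +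
          n * ((2 * (n * (m + 1)) + 9) + 1)) ∧
      ∀ x ∈ unitCube n, ∀ i, |Net.eval x i - F x i| ≤
        (1 + blendConst m) * (B * (2 / N) ^ α) * (∑ i ∈ Finset.range n, blendConst m ^ i) +
        ((N + 1) * (m + 1)) ^ n * (2 * B *
          (((m + 1) * N) ^ (m * n) * (n * (m + 1) * (3 * (1 / 4 ^ s))))) := by
  classical
  subst hm
  set m := ⌊α⌋₊
  choose c hcb hc using fun i => holderBall.exists_blend hα hB.le (hF i) hN
  choose p hp hpe using fun a : Fin n → Fin (N + 1) × Fin (m + 1) => exists_computes_blend hN a s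
  let Φ : (Fin n → ℝ) → (Fin n → ℝ) := fun x i =>
    if hx : x ∈ unitCube n then ∑ a, c i a * p a ⟨x, hx⟩ + F 0 i else 0
  -- These scalar functions do not depend on `F` or on the output coordinate; both enter only
  -- through the output layer.
  let φ : G × (Fin n → Fin (N + 1) × Fin (m + 1)) → unitCube n → ℝ := fun ω =>
    p ω.2 ∘ cubePerm ω.1.1
  obtain ⟨Net, h1, h2, h3⟩ := ReLUNet.exists_of_computes (φ := φ)
    (fun ω => (hp ω.2).comp_cubePerm ω.1.1)
    -- Output `i` of the average reads component `σ i` of `Φ` in the term of `σ`.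
    (fun (i : Fin n) ω => (Fintype.card G : ℝ)⁻¹ * c (ω.1.1 i) ω.2)
    (fun i => (Fintype.card G : ℝ)⁻¹ * ∑ σ : G, F 0 (σ.1 i))
  have heval : ∀ x ∈ unitCube n, Net.eval x = groupAverage G Φ x := by
    intro x hx
    ext i
    rw [h3 ⟨x, hx⟩ i, Fintype.sum_prod_type, groupAverage]
    simp only [mul_assoc, ← Finset.mul_sum, ← mul_add, ← Finset.sum_add_distrib]
    congr 1
    refine Finset.sum_congr rfl fun σ _ => ?_
    simp only [Φ, permAct_mem_unitCube _ hx, dif_pos]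
    rfl
  refine ⟨Net, fun σ hσ x hx => ?_, by rw [h1]; ring, ?_, fun x hx i => ?_⟩
  · rw [heval x hx, heval _ (permAct_mem_unitCube σ hx), groupAverage_permAct G Φ hσ]
  · refine h2.trans (Nat.mul_le_mul_right _ ?_)
    rw [Fintype.card_prod]
    refine Nat.mul_le_mul ?_ (by simp)
    calc Fintype.card G ≤ Fintype.card (Equiv.Perm (Fin n)) :=
          Fintype.card_le_of_injective _ Subtype.val_injective
      _ = n.factorial := by rw [Fintype.card_perm, Fintype.card_fin]
  · rw [heval x hx]
    refine abs_groupAverage_sub_le G hG (fun x hx i => ?_) hx i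
    have e1 := hc i x hx
    have e2 : |∑ a, c i a * (p a ⟨x, hx⟩ - ∏ j, blendFn N m (a j) (x j))| ≤
        ((N + 1) * (m + 1)) ^ n * (2 * B *
          (((m + 1) * N) ^ (m * n) * (n * (m + 1) * (3 * (1 / 4 ^ s))))) := by
      refine (Finset.abs_sum_le_sum_abs _ _).trans ((Finset.sum_le_card_nsmul _ _
        (2 * B * (((m + 1) * N) ^ (m * n) * (n * (m + 1) * (3 * (1 / 4 ^ s)))))
          fun a _ => ?_).trans_eq ?_)
      · rw [abs_mul]
        exact mul_le_mul (hcb i a) (hpe a ⟨x, hx⟩) (abs_nonneg _) (by positivity)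
      · simp [m]
    have e3 : Φ x i - F x i = (∑ a, c i a * (p a ⟨x, hx⟩ - ∏ j, blendFn N m (a j) (x j))) -
        (F x i - F 0 i - ∑ a, c i a * ∏ j, blendFn N m (a j) (x j)) := by
      simp only [Φ, hx, dif_pos, mul_sub, Finset.sum_sub_distrib]
      ring
    rw [e3]
    refine (abs_sub _ _).trans ?_
    rw [add_comm]
    exact add_le_add e1 e2

lemma one_le_numOrbits {n : ℕ} (hn : 0 < n) (G : Subgroup (Equiv.Perm (Fin n))) :
    1 ≤ numOrbits G := by
  have : Nonempty (MulAction.orbitRel.Quotient G (Fin n)) := ⟨Quotient.mk'' ⟨0, hn⟩⟩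
  exact Nat.card_pos

theorem mainTheorem4 (n : ℕ) (α B : ℝ) (hα : 0 < α) (hB : 0 < B) :
    ∃ L P : ℝ → ℕ,
      (fun ε : ℝ => (L ε : ℝ)) =O[𝓝[>] 0] (fun ε : ℝ => Real.log (1 / ε)) ∧
      (fun ε : ℝ => (P ε : ℝ)) =O[𝓝[>] 0]
        (fun ε : ℝ => ε ^ (-(n : ℝ) / α) * Real.log (1 / ε)) ∧
      ∀ G : Subgroup (Equiv.Perm (Fin n)), ∀ ε : ℝ, 0 < ε →
        ∀ F : (Fin n → ℝ) → (Fin n → ℝ),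
          IsCubeEquivariant G F →
          (∀ i : Fin n, (fun x => F x i) ∈ holderBall n α B) →
          ∃ N : ReLUNet n n,
            IsCubeEquivariant G N.eval ∧
            N.numLayers ≤ L ε ∧
            N.numParams ≤ numOrbits G * P ε ∧
            ∀ x ∈ unitCube n, ‖N.eval x - F x‖ ≤ ε := by
  classical
  set m := ⌊α⌋₊ with hm
  set w := 2 * (n * (m + 1)) + 9 with hw
  have hΛ := one_le_blendConst m
  have hS : 0 ≤ ∑ i ∈ Finset.range n, blendConst m ^ i :=
    Finset.sum_nonneg fun i _ => pow_nonneg (by linarith) _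
  obtain ⟨N, s, hNs, hNO, hsO⟩ := exists_grid_depth
    -- The summand `1 +` here and the factor `n + 1` in `C₂` keep the constants positive when `n =
    -- 0`. The exponent `n + m * n` collects the number of terms and the growth of `blendScale`.
    (C₁ := (1 + blendConst m) * B * (1 + ∑ i ∈ Finset.range n, blendConst m ^ i))
    (C₂ := (m + 1) ^ n * (2 * B * ((m + 1) ^ (m * n) * ((n + 1) * (m + 1) * 3)))) hα
    (by positivity) (by positivity) (n + m * n)
  refine ⟨fun ε => n * (m + 1) * (s ε + 2) + 3,
    fun ε => n.factorial * ((N ε + 1) * (m + 1)) ^ n * (w * (n + 1) +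
      (1 + n * (m + 1) * (s ε + 2)) * (w * (w + 1)) + n * (w + 1)), ?_, ?_, ?_⟩
  · push_cast
    exact ((hsO.add (isBigO_const_log 2)).const_mul_left _).add (isBigO_const_log 3)
  · push_cast
    refine IsBigO.mul ?_ ?_
    · refine IsBigO.const_mul_left ?_ _
      have h1 : (fun ε : ℝ => (((N ε : ℝ) + 1) * (m + 1)) ^ n) =O[𝓝[>] 0]
          fun ε : ℝ => (ε ^ (-1 / α)) ^ n := by
        refine IsBigO.pow ?_ n
        simpa only [mul_comm] using hNO.const_mul_left ((m : ℝ) + 1)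
      refine h1.congr' EventuallyEq.rfl ?_
      filter_upwards [self_mem_nhdsWithin] with ε hε
      rw [← Real.rpow_natCast, ← Real.rpow_mul (Set.mem_Ioi.1 hε).le]
      congr 1
      ring
    · have hdepth := (isBigO_const_log 1).add
        ((hsO.add (isBigO_const_log 2)).const_mul_left ((n : ℝ) * (m + 1)))
      exact ((isBigO_const_log _).add ((hdepth.const_mul_left ((w : ℝ) * (w + 1))).congr_left
        fun _ => mul_comm _ _)).add (isBigO_const_log _)
  · intro G ε hε F hG hF
    obtain ⟨hN1, he1, he2⟩ := hNs ε hε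
    obtain ⟨Net, h1, h2, h3, h4⟩ := exists_equivariant_net hα hB hm hN1 (s ε) G hG hF
    -- For `n = 0` there are no orbits, so a network without nonzero parameters is required.
    rcases Nat.eq_zero_or_pos n with rfl | hn
    · refine ⟨.output 0 0, fun _ _ _ _ => Subsingleton.elim _ _, ?_, ?_, fun x _ => ?_⟩
      · simp [ReLUNet.numLayers]
      · simp [ReLUNet.numParams, ReLUNet.layerParams]
      · rw [Subsingleton.elim (_ - _) (0 : Fin 0 → ℝ), norm_zero]
        exact hε.le
    · refine ⟨Net, h1, h2.le, h3.trans (Nat.le_mul_of_pos_left _ (one_le_numOrbits hn G)),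
        fun x hx => ?_⟩
      refine (pi_norm_le_iff_of_nonneg hε.le).2 fun i => ?_
      rw [Real.norm_eq_abs]
      refine (h4 x hx i).trans ((add_le_add ?_ ?_).trans_eq (add_halves ε))
      · refine le_trans ?_ he1
        have : 0 ≤ (1 + blendConst m) * (B * (2 / (N ε : ℝ)) ^ α) := by positivity
        nlinarith
      · refine le_trans ?_ he2
        calc _ ≤ (((N ε : ℝ) + 1) * (m + 1)) ^ n * (2 * B *
              (((m + 1) * ((N ε : ℝ) + 1)) ^ (m * n) *
                ((n + 1) * (m + 1) * (3 * (1 / 4 ^ s ε))))) := by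
              gcongr <;> linarith
          _ = _ := by
              rw [mul_pow, mul_pow, pow_add]
              ring
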